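/- Let $\mathcal S,\mathcal A$ be finite state and action sets, with transition probabilities $p(s'\mid s,a)$, reward laws $\nu(\cdot\mid s,a,s')$ on $\mathbb R$, a behavior policy $b(a\mid s)$, a discount rate $\gamma\in[0,1)$, feature vectors $x(s)\in\mathbb R^p$ and a probability distribution $d$ on $\mathcal S$. Let $P$ be the state transition matrix under $b$, $R$ the vector of expected rewards $R_s=\mathrm E(r\mid s)$ under $b$, $\mathbf B V=R+\gamma PV$ the Bellman operator, $X$ the matrix with rows $x(s)^\top$, $D=\mathrm{diag}(d)$, $V_w=Xw$, and $\Pi=X(X^\top DX)^{-1}X^\top D$. Let $(s_n,a_n,r_n,s_n')_{n\ge 0}$ be transitions such that for each $n$: $s_n\sim d$, $a_n\sim b(\cdot\mid s_n)$, $s_n'\sim p(\cdot\mid s_n,a_n)$, $r_n\sim\nu(\cdot\mid s_n,a_n,s_n')$. Write $x_n=x(s_n)$ and $x_n'=x(s_n')$ (the feature vector of the successor state, commonly written $x_{n+1}$). Set $$G_n=\begin{pmatrix}x_nx_n^\top & x_n(x_n-\gamma x_n')^\top\\ -(x_n-\gamma x_n')x_n^\top & 0\end{pmatrix},\quad H_n=\begin{pmatrix}0&0\\0&x_nx_n^\top\end{pmatrix},\quad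 g_{n+1}=\begin{pmatrix}r_nx_n\\0\end{pmatrix}.$$ Consider the Gradient-DD iteration for $\rho_n=(\eta_n^\top,w_n^\top)^\top\in\mathbb R^{2p}$, started from arbitrary random vectors $\rho_0,\rho_1$: for $n\ge1$, $$\rho_{n+1}=\rho_n-\kappa\alpha_nH_n(\rho_n-\rho_{n-1})+\alpha_n(-G_n\rho_n+g_{n+1}).$$ Suppose that (A0) $\alpha_n\in(0,1)$ for $n\ge 1$, $\sum_{n\ge1}\alpha_n=\infty$ and $\sum_{n\ge1}\alpha_n^2<\infty$; (A1) the triples $(x_n,r_n,x_n')$ are i.i.d. with uniformly bounded second moments; (A2) $\mathrm E[(x_n-\gamma x_n')x_n^\top]$ and $\mathrm E[x_nx_n^\top]$ are nonsingular; (A3) the increments $\rho_{n+1}-\rho_n$ are bounded in probability, i.e. for every $\varepsilon>0$ there is $C$ with $\Pr(\|\rho_{n+1}-\rho_n\|>C)\le\varepsilon$ for all $n$; (A4) $\kappa\in[0,\infty)$ is constant. Then there is exactly one TD fixed point $w^*\in\mathbb R^p$, that is, one point with $V_{w^*}=\Pi\mathbf B V_{w^*}$, and $w_n\to w^*$ with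 probability $1$ as $n\to\infty$. -/

import Mathlib

open MeasureTheory ProbabilityTheory Filter Topology
open scoped Matrix ENNReal

noncomputable section

/-- A Markov decision process with state set `S`, action set `A`, transition probabilities
`trans s a s'`, and rewards whose law `reward s a s'` depends on the state, the action and the
next state. -/
structure MDP (S A : Type*) where
  trans : S → A → PMF S
  reward : S → A → S → ProbabilityMeasure ℝ

namespace MDP

variable {S A : Type*} [Fintype S] [Fintype A]

/-- The matrix `P` of state transition probabilities under the policy `b`. -/
def transitionMatrix (M : MDP S A) (b : S → PMF A) : Matrix S S ℝ :=
  Matrix.of fun s s' => ∑ a, (b s a).toReal * (M.trans s a s').toReal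

/-- The reward vector `R`, with components `E(r_n | s_n = s)` under the policy `b`. -/
def rewardVector (M : MDP S A) (b : S → PMF A) : S → ℝ := fun s =>
  ∑ a, ∑ s', (b s a).toReal * (M.trans s a s').toReal *
    ∫ y, y ∂(M.reward s a s' : Measure ℝ)

/-- The Bellman operator `B V = R + γ P V`. -/
def bellman (M : MDP S A) (b : S → PMF A) (γ : ℝ) (V : S → ℝ) : S → ℝ :=
  M.rewardVector b + γ • (M.transitionMatrix b *ᵥ V)

end MDP

/-- The law of one transition `(s, a, r, s')`: the state is drawn from `d`, the action from the
behavior policy `b`, the next state and the reward from the decision process `M`. -/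
def HasTransitionLaw {S A Ω : Type*} [MeasurableSpace Ω] (M : MDP S A) (b : S → PMF A)
    (d : PMF S) (μ : Measure Ω) (s : Ω → S) (a : Ω → A) (r : Ω → ℝ) (s' : Ω → S) : Prop :=
  ∀ (i : S) (k : A) (j : S) (B : Set ℝ), MeasurableSet B →
    μ {ω | s ω = i ∧ a ω = k ∧ s' ω = j ∧ r ω ∈ B} =
      d i * b i k * M.trans i k j * (M.reward i k j : Measure ℝ) B

section LinearApproximation

variable {S : Type*} [Fintype S] [DecidableEq S] {p : ℕ}

/-- The matrix `X` whose rows are the feature vectors `x(s)`. -/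
def featureMatrix (x : S → Fin p → ℝ) : Matrix S (Fin p) ℝ := Matrix.of x

/-- The approximate value function `V_w = X w`. -/
def approxValue (x : S → Fin p → ℝ) (w : Fin p → ℝ) : S → ℝ := featureMatrix x *ᵥ w

/-- The diagonal matrix `D` of state probabilities. -/
def stateWeights (d : PMF S) : Matrix S S ℝ := Matrix.diagonal fun s => (d s).toReal

/-- The projection `Π = X (Xᵀ D X)⁻¹ Xᵀ D`. -/
def projection (x : S → Fin p → ℝ) (d : PMF S) : Matrix S S ℝ :=
  featureMatrix x * ((featureMatrix x)ᵀ * stateWeights d * featureMatrix x)⁻¹ *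
    (featureMatrix x)ᵀ * stateWeights d

/-- `w` is a TD fixed point: `V_w = Π B V_w`. -/
def IsTDFixedPoint {A : Type*} [Fintype A] (M : MDP S A) (b : S → PMF A) (γ : ℝ)
    (x : S → Fin p → ℝ) (d : PMF S) (w : Fin p → ℝ) : Prop :=
  approxValue x w = projection x d *ᵥ M.bellman b γ (approxValue x w)

end LinearApproximation

section Iteration

variable {p : ℕ}

/-- The combined parameter vector `ρ = (η, w)`: `Sum.inl` indexes `η`, `Sum.inr` indexes `w`. -/
abbrev Param (p : ℕ) : Type := Fin p ⊕ Fin p → ℝ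

/-- The weight component `w` of `ρ = (η, w)`. -/
def Param.weights (ρ : Param p) : Fin p → ℝ := fun i => ρ (Sum.inr i)

/-- The block matrix `G_n`, for the feature vectors `y = x_n` and `y' = x_{n+1}`. -/
def sampleG (γ : ℝ) (y y' : Fin p → ℝ) : Matrix (Fin p ⊕ Fin p) (Fin p ⊕ Fin p) ℝ :=
  Matrix.fromBlocks (Matrix.vecMulVec y y) (Matrix.vecMulVec y (y - γ • y'))
    (-Matrix.vecMulVec (y - γ • y') y) 0

/-- The block matrix `H_n`, for the feature vector `y = x_n`. -/
def sampleH (y : Fin p → ℝ) : Matrix (Fin p ⊕ Fin p) (Fin p ⊕ Fin p) ℝ :=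
  Matrix.fromBlocks 0 0 0 (Matrix.vecMulVec y y)

/-- The vector `g_{n+1} = (r_n x_n, 0)`. -/
def sampleg (r : ℝ) (y : Fin p → ℝ) : Param p := Sum.elim (r • y) 0

/-- One Gradient-DD update, from the current iterate `ρ` and the previous iterate `ρ'`. -/
def gradientDDStep (γ κ α r : ℝ) (y y' : Fin p → ℝ) (ρ ρ' : Param p) : Param p :=
  ρ - (κ * α) • (sampleH y *ᵥ (ρ - ρ')) + α • (-(sampleG γ y y' *ᵥ ρ) + sampleg r y)

end Iteration

/-- The entrywise expectation of a random matrix. -/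
def expMatrix {Ω m n : Type*} [MeasurableSpace Ω] (μ : Measure Ω) (F : Ω → Matrix m n ℝ) :
    Matrix m n ℝ :=
  Matrix.of fun i j => ∫ ω, F ω i j ∂μ

/-- The sequence `u` of random vectors is bounded in probability (uniformly tight). -/
def BoundedInProbability {Ω E : Type*} [MeasurableSpace Ω] [Norm E] (μ : Measure Ω)
    (u : ℕ → Ω → E) : Prop :=
  ∀ ε : ℝ≥0∞, 0 < ε → ∃ C : ℝ, ∀ n, μ {ω | C < ‖u n ω‖} ≤ ε

end

/-! Let `A = E (x - γ x') xᵀ` and `C = E x xᵀ`. Multiplying the fixed point equation by `XᵀD` turns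
it into `Aᵀ w = XᵀD R`, which has one solution because `A` is invertible. With `ρ⋆ = (0, w⋆)`, `u =
ρ - ρ⋆` and `δ` the last increment, the second-order recursion becomes a first-order chain in `(u,
δ)`, driven by independent samples, whose mean direction is `-G u - κ H δ`.

The plain Euclidean norm is not a strict Lyapunov function: the off-diagonal blocks of `G` cancel
and only `η · C η` survives. A small cross term `2 ε η · Aᵀ w` repairs this, since its derivative
contributes `ε |Aᵀ w|²` (`exists_lyapunov_form`). The momentum costs a multiple of `‖δ‖²`, but the
next increment is itself of order `α`, so `W = B u u + ‖δ‖²` satisfies `E W_{n+1} ≤ (1 - c' α_n) W_n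
+ C α_n²` for small steps (`exists_lyapunov_drift`). Then `W` plus the tail of `∑ C α_n²` is a
nonnegative supermartingale, hence converges almost surely, while `E W → 0` because `∑ α_n = ∞`; so
the limit is zero (`ae_tendsto_zero_of_lyapunov`).

This argument needs a deterministic start, whereas the initial vectors are arbitrary: possibly
non-integrable and dependent on the samples. Each step is affine in the state, so convergence from
the origin and from a basis gives convergence from every start off a single null set
(`tendsto_zero_of_basis`). The random state at a time after which the step sizes are small can then
be inserted path by path. -/

/-! ### Almost sure convergence from a Lyapunov drift -/

/-- A nonnegative sequence with `e (n+1) ≤ (1 - a n) e n + b n`, `∑ a = ∞`, `∑ b < ∞`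
tends to zero. -/
theorem tendsto_zero_of_le_one_sub_mul_add {e a b : ℕ → ℝ} (he : ∀ n, 0 ≤ e n)
    (ha : ∀ n, 0 ≤ a n) (hb : ∀ n, 0 ≤ b n) (ha_sum : ¬ Summable a) (hb_sum : Summable b)
    (h : ∀ n, e (n + 1) ≤ (1 - a n) * e n + b n) : Tendsto e atTop (𝓝 0) := by
  -- Adding the tail of `∑ b` absorbs the perturbation: `e + t` is nonincreasing and loses at least
  -- `a n * e n` at each step.
  set t : ℕ → ℝ := fun n => ∑' k, b (k + n) with ht
  have ht0 : Tendsto t atTop (𝓝 0) := tendsto_sum_nat_add b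
  have htpos : ∀ n, 0 ≤ t n := fun n => tsum_nonneg fun k => hb _
  have htsucc : ∀ n, t n = b n + t (n + 1) := fun n => by
    have := ((summable_nat_add_iff n).2 hb_sum).tsum_eq_zero_add
    simp only [ht]
    rw [this]
    simp [add_comm, add_left_comm]
  have hdec : ∀ n, e (n + 1) + t (n + 1) + a n * e n ≤ e n + t n := fun n => by
    rw [htsucc n]; nlinarith [h n]
  have hanti : Antitone fun n => e n + t n := antitone_nat_of_succ_le fun n => by
    have := mul_nonneg (ha n) (he n); have := hdec n; linarith
  obtain ⟨l, hl⟩ : ∃ l, Tendsto (fun n => e n + t n) atTop (𝓝 l) :=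
    ⟨_, tendsto_atTop_ciInf hanti ⟨0, by rintro _ ⟨n, rfl⟩; have := he n; have := htpos n; positivity⟩⟩
  have hel : Tendsto e atTop (𝓝 l) := by simpa using hl.sub ht0
  have hl0 : 0 ≤ l := ge_of_tendsto' hel he
  rcases hl0.eq_or_lt with rfl | hlpos
  · exact hel
  exfalso
  -- A positive limit is impossible: the losses `a n * e n` telescope to a finite sum, and
  -- eventually `e n > l / 2`, which would make `a` summable.
  have hsum : Summable fun n => a n * e n := by
    refine summable_of_sum_range_le (c := e 0 + t 0) (fun n => mul_nonneg (ha n) (he n)) fun n => ?_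
    have : ∑ i ∈ Finset.range n, a i * e i ≤ (e 0 + t 0) - (e n + t n) := by
      induction n with
      | zero => simp
      | succ k ih => rw [Finset.sum_range_succ]; have := hdec k; linarith
    have := he n; have := htpos n; linarith
  obtain ⟨N, hN⟩ := eventually_atTop.1 (hel.eventually (lt_mem_nhds (half_lt_self hlpos)))
  apply ha_sum
  rw [← summable_nat_add_iff N]
  refine Summable.of_nonneg_of_le (fun n => ha _) (fun n => ?_)
    (((summable_nat_add_iff N).2 hsum).mul_left (2 / l))
  have h1 := hN (n + N) (by omega)
  have h2 := ha (n + N)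
  rw [div_mul_eq_mul_div, le_div_iff₀ hlpos]
  nlinarith

/-- If `X` is measurable for a σ-algebra `m` independent of `Y`, then an upper bound for the
expectation of `h (z, Y)` for fixed `z` is an upper bound for `h (X, Y)` on average over each
`m`-measurable set. -/
theorem setIntegral_le_of_indep {Ω Z 𝒴 : Type*} {m m0 : MeasurableSpace Ω} [MeasurableSpace Z]
    [MeasurableSpace 𝒴] {μ : Measure Ω} [IsProbabilityMeasure μ] (hm : m ≤ m0) {X : Ω → Z}
    {Y : Ω → 𝒴} (hX : Measurable[m] X) (hY : Measurable Y)
    (hind : Indep m (MeasurableSpace.comap Y inferInstance) μ) {h : Z × 𝒴 → ℝ} {k : Z → ℝ}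
    (hh : Measurable h) (hk : Measurable k) (h0 : ∀ q, 0 ≤ h q)
    (hint : ∀ z, Integrable (fun ω => h (z, Y ω)) μ) (hle : ∀ z, ∫ ω, h (z, Y ω) ∂μ ≤ k z)
    (hkX : Integrable (fun ω => k (X ω)) μ) :
    Integrable (fun ω => h (X ω, Y ω)) μ ∧
      ∀ s, MeasurableSet[m] s → ∫ ω in s, h (X ω, Y ω) ∂μ ≤ ∫ ω in s, k (X ω) ∂μ := by
  have hX0 : Measurable X := hX.mono hm le_rfl
  have hk0 : ∀ z, 0 ≤ k z := fun z => (integral_nonneg fun ω => h0 _).trans (hle z)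
  have hhXY : Measurable fun ω => h (X ω, Y ω) := hh.comp (hX0.prodMk hY)
  -- Working with `lintegral` lets Tonelli apply before `h (X, Y)` is known to be integrable.
  have key : ∀ s, MeasurableSet[m] s →
      ∫⁻ ω in s, ENNReal.ofReal (h (X ω, Y ω)) ∂μ ≤ ∫⁻ ω in s, ENNReal.ofReal (k (X ω)) ∂μ := by
    intro s hs
    -- The indicator of `s` is carried as an extra coordinate of `X`; it is `m`-measurable, so the
    -- pair is still independent of `Y`.
    set I : Ω → ℝ≥0∞ := s.indicator 1 with hI
    have hIm : Measurable[m] I := (@measurable_one _ _ _ m _).indicator hs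
    have hIm0 : Measurable I := hIm.mono hm le_rfl
    have hXI : Measurable[m] fun ω => (X ω, I ω) := hX.prodMk hIm
    have hXI0 : Measurable fun ω => (X ω, I ω) := hX0.prodMk hIm0
    have hi : IndepFun (fun ω => (X ω, I ω)) Y μ := by
      rw [IndepFun_iff_Indep]
      exact indep_of_indep_of_le_left hind hXI.comap_le
    rw [indepFun_iff_map_prod_eq_prod_map_map hXI0.aemeasurable hY.aemeasurable] at hi
    have hconv : ∀ f : Ω → ℝ≥0∞, ∫⁻ ω in s, f ω ∂μ = ∫⁻ ω, I ω * f ω ∂μ := fun f => by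
      rw [← lintegral_indicator (hm _ hs)]
      congr 1; ext ω
      by_cases hω : ω ∈ s <;> simp [hI, hω]
    have hg : Measurable fun q : (Z × ℝ≥0∞) × 𝒴 => q.1.2 * ENNReal.ofReal (h (q.1.1, q.2)) :=
      measurable_fst.snd.mul (hh.comp (measurable_fst.fst.prodMk measurable_snd)).ennreal_ofReal
    have hg' : Measurable fun q : Z × ℝ≥0∞ => q.2 * ENNReal.ofReal (k q.1) :=
      measurable_snd.mul (hk.comp measurable_fst).ennreal_ofReal
    rw [hconv, hconv]
    calc ∫⁻ ω, I ω * ENNReal.ofReal (h (X ω, Y ω)) ∂μ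
        = ∫⁻ q, q.1.2 * ENNReal.ofReal (h (q.1.1, q.2))
            ∂(μ.map fun ω => ((X ω, I ω), Y ω)) := (lintegral_map hg (hXI0.prodMk hY)).symm
      _ = ∫⁻ q, ∫⁻ y, q.2 * ENNReal.ofReal (h (q.1, y)) ∂(μ.map Y)
            ∂(μ.map fun ω => (X ω, I ω)) := by
          rw [hi, lintegral_prod _ hg.aemeasurable]
      _ ≤ ∫⁻ q, q.2 * ENNReal.ofReal (k q.1) ∂(μ.map fun ω => (X ω, I ω)) := by
          refine lintegral_mono fun q => ?_
          have hq : Measurable fun y => h (q.1, y) := hh.comp measurable_prodMk_left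
          simp only
          rw [lintegral_const_mul _ hq.ennreal_ofReal, lintegral_map hq.ennreal_ofReal hY,
            ← ofReal_integral_eq_lintegral_ofReal (hint _) (ae_of_all _ fun ω => h0 _)]
          gcongr
          exact hle _
      _ = ∫⁻ ω, I ω * ENNReal.ofReal (k (X ω)) ∂μ := lintegral_map hg' hXI0
  have hfin : ∀ s, MeasurableSet[m] s → ∫⁻ ω in s, ENNReal.ofReal (k (X ω)) ∂μ ≠ ⊤ := fun s _ =>
    (hkX.integrableOn (s := s)).lintegral_lt_top.ne
  refine ⟨⟨hhXY.aestronglyMeasurable, ?_⟩, fun s hs => ?_⟩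
  · rw [hasFiniteIntegral_iff_ofReal (ae_of_all _ fun ω => h0 _)]
    have h1 := key Set.univ MeasurableSet.univ
    have h2 := hfin Set.univ MeasurableSet.univ
    rw [Measure.restrict_univ] at h1 h2
    exact h1.trans_lt h2.lt_top
  · rw [integral_eq_lintegral_of_nonneg_ae (ae_of_all _ fun ω => h0 _)
        hhXY.aestronglyMeasurable,
      integral_eq_lintegral_of_nonneg_ae (ae_of_all _ fun ω => hk0 _)
        (hk.comp hX0).aestronglyMeasurable]
    exact ENNReal.toReal_mono (hfin s hs) (key s hs)

/-- A function `W` of a Markov chain driven by independent noise tends to zero almost surely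
if its expected one-step change satisfies a Lyapunov condition. -/
theorem ae_tendsto_zero_of_lyapunov {Ω Z 𝒴 : Type*} [MeasurableSpace Ω] [MeasurableSpace Z]
    [MeasurableSpace 𝒴] {μ : Measure Ω} [IsProbabilityMeasure μ] {Y : ℕ → Ω → 𝒴}
    (hY : ∀ n, Measurable (Y n)) (hind : iIndepFun Y μ) {Φ : ℕ → Z → 𝒴 → Z}
    (hΦ : ∀ n, Measurable (Function.uncurry (Φ n))) {W : Z → ℝ} (hW : Measurable W)
    (hW0 : ∀ z, 0 ≤ W z) {a b : ℕ → ℝ} (ha : ∀ n, 0 ≤ a n)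
    (hb : ∀ n, 0 ≤ b n) (ha_sum : ¬ Summable a) (hb_sum : Summable b)
    (hint : ∀ n z, Integrable (fun ω => W (Φ n z (Y n ω))) μ)
    (hdrift : ∀ n z, ∫ ω, W (Φ n z (Y n ω)) ∂μ ≤ (1 - a n) * W z + b n)
    {z : ℕ → Ω → Z} (z₀ : Z) (hz0 : ∀ ω, z 0 ω = z₀)
    (hz : ∀ n ω, z (n + 1) ω = Φ n (z n ω) (Y n ω)) :
    ∀ᵐ ω ∂μ, Tendsto (fun n => W (z n ω)) atTop (𝓝 0) := by
  -- The strict bound `i < n` makes `z n` measurable for `ℱ n` while `Y n` stays independent of it.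
  let ℱ : Filtration ℕ ‹MeasurableSpace Ω› :=
    { seq := fun n => ⨆ i ∈ Set.Iio n, MeasurableSpace.comap (Y i) inferInstance
      mono' := fun i j hij => biSup_mono fun k hk => lt_of_lt_of_le hk hij
      le' := fun n => iSup₂_le fun i _ => (hY i).comap_le }
  have hYℱ : ∀ n, Measurable[ℱ (n + 1)] (Y n) := fun n => by
    rw [measurable_iff_comap_le]
    exact le_iSup₂_of_le (f := fun i (_ : i ∈ Set.Iio (n + 1)) =>
      MeasurableSpace.comap (Y i) inferInstance) n (Nat.lt_succ_self n) le_rfl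
  have hzm : ∀ n, Measurable[ℱ n] (z n) := by
    intro n
    induction n with
    | zero => rw [show z 0 = fun _ => z₀ from funext hz0]; exact measurable_const
    | succ n ih =>
      rw [show z (n + 1) = fun ω => Φ n (z n ω) (Y n ω) from funext (hz n)]
      exact (hΦ n).comp ((ih.mono (ℱ.mono n.le_succ) le_rfl).prodMk (hYℱ n))
  have hindep : ∀ n, Indep (ℱ n) (MeasurableSpace.comap (Y n) inferInstance) μ := fun n => by
    have := indep_iSup_of_disjoint (fun i => (hY i).comap_le) ((iIndepFun_iff_iIndep _ _ _).1 hind)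
      (S := Set.Iio n) (T := {n}) (by simp)
    rw [iSup_singleton] at this
    exact this
  have hWz : ∀ n, Measurable fun ω => W (z n ω) := fun n =>
    hW.comp ((hzm n).mono (ℱ.le n) le_rfl)
  have hstep : ∀ n, Integrable (fun ω => W (z n ω)) μ →
      Integrable (fun ω => W (z (n + 1) ω)) μ ∧ ∀ s, MeasurableSet[ℱ n] s →
        ∫ ω in s, W (z (n + 1) ω) ∂μ ≤ ∫ ω in s, ((1 - a n) * W (z n ω) + b n) ∂μ := by
    intro n hn
    simp only [hz]
    exact setIntegral_le_of_indep (ℱ.le n) (hzm n) (hY n) (hindep n)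
      (h := fun q => W (Φ n q.1 q.2)) (k := fun x => (1 - a n) * W x + b n)
      (hW.comp (hΦ n)) ((hW.const_mul _).add_const _) (fun q => hW0 _) (hint n) (hdrift n)
      ((hn.const_mul _).add (integrable_const _))
  have hWint : ∀ n, Integrable (fun ω => W (z n ω)) μ := by
    intro n
    induction n with
    | zero => simp [hz0]
    | succ n ih => exact (hstep n ih).1
  have hE : Tendsto (fun n => ∫ ω, W (z n ω) ∂μ) atTop (𝓝 0) := by
    refine tendsto_zero_of_le_one_sub_mul_add (fun n => integral_nonneg fun ω => hW0 _)
      ha hb ha_sum hb_sum fun n => ?_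
    have := (hstep n (hWint n)).2 Set.univ MeasurableSet.univ
    rw [Measure.restrict_univ, integral_add ((hWint n).const_mul _) (integrable_const _),
      integral_const_mul] at this
    simpa using this
  set t : ℕ → ℝ := fun n => ∑' k, b (k + n) with ht
  have ht0 : Tendsto t atTop (𝓝 0) := tendsto_sum_nat_add b
  have htpos : ∀ n, 0 ≤ t n := fun n => tsum_nonneg fun k => hb _
  have htsucc : ∀ n, t n = b n + t (n + 1) := fun n => by
    have := ((summable_nat_add_iff n).2 hb_sum).tsum_eq_zero_add
    simp only [ht]
    rw [this]
    simp [add_comm, add_left_comm]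
  have hsup : Supermartingale (fun n ω => W (z n ω) + t n) ℱ μ := by
    refine supermartingale_of_setIntegral_succ_le (fun n => ?_)
      (fun n => (hWint n).add (integrable_const _)) fun n s hs => ?_
    · exact ((hW.comp (hzm n)).add_const _).stronglyMeasurable
    · have h1 := (hstep n (hWint n)).2 s hs
      rw [integral_add (hWint _).integrableOn (integrable_const _)]
      have h2 : ∫ ω in s, ((1 - a n) * W (z n ω) + b n) ∂μ ≤ ∫ ω in s, (W (z n ω) + b n) ∂μ := by
        refine integral_mono (((hWint n).const_mul _).add (integrable_const _)).integrableOn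
          ((hWint n).add (integrable_const _)).integrableOn fun ω => ?_
        have := mul_nonneg (ha n) (hW0 (z n ω))
        simp only; nlinarith
      rw [integral_add (hWint _).integrableOn (integrable_const _)] at h2 ⊢
      simp only [integral_const, smul_eq_mul] at h2 ⊢
      rw [htsucc n, mul_add]
      linarith
  have hbdd : ∀ n, ∫ ω, (W (z n ω) + t n) ∂μ ≤ ∫ ω, (W (z 0 ω) + t 0) ∂μ := fun n => by
    simpa using hsup.setIntegral_le (Nat.zero_le n) MeasurableSet.univ
  have hconv : ∀ᵐ ω ∂μ, ∃ c, Tendsto (fun n => -(W (z n ω) + t n)) atTop (𝓝 c) := by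
    refine Submartingale.exists_ae_tendsto_of_bdd hsup.neg
      (R := (∫ ω, (W (z 0 ω) + t 0) ∂μ).toNNReal) fun n => ?_
    rw [show (fun ω => -(W (z n ω) + t n)) = -fun ω => W (z n ω) + t n from rfl, eLpNorm_neg,
      eLpNorm_one_eq_lintegral_enorm]
    have : ∀ ω, ‖W (z n ω) + t n‖ₑ = ENNReal.ofReal (W (z n ω) + t n) := fun ω =>
      Real.enorm_of_nonneg (add_nonneg (hW0 _) (htpos n))
    simp only [this]
    rw [← ofReal_integral_eq_lintegral_ofReal (f := fun ω => W (z n ω) + t n)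
      ((hWint n).add (integrable_const _)) (ae_of_all _ fun ω => add_nonneg (hW0 _) (htpos n))]
    exact ENNReal.ofReal_le_ofReal (hbdd n)
  -- Convergence of the means identifies the almost sure limit, through a subsequence that tends to
  -- zero almost surely.
  have hmeas : TendstoInMeasure μ (fun n ω => W (z n ω)) atTop fun _ => 0 := by
    refine tendstoInMeasure_of_tendsto_eLpNorm one_ne_zero
      (fun n => (hWz n).aestronglyMeasurable) aestronglyMeasurable_const ?_
    have : ∀ n, eLpNorm ((fun ω => W (z n ω)) - fun _ => (0 : ℝ)) 1 μ =
        ENNReal.ofReal (∫ ω, W (z n ω) ∂μ) := fun n => by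
      rw [ofReal_integral_eq_lintegral_ofReal (hWint n) (ae_of_all _ fun ω => hW0 _),
        eLpNorm_one_eq_lintegral_enorm]
      simp [Real.enorm_of_nonneg (hW0 _)]
    simp only [this]
    simpa using ENNReal.tendsto_ofReal hE
  obtain ⟨ns, hns, hsub⟩ := hmeas.exists_seq_tendsto_ae
  filter_upwards [hconv, hsub] with ω ⟨c, hc⟩ hω
  have h1 : Tendsto (fun n => W (z n ω)) atTop (𝓝 (-c)) := by
    simpa using hc.neg.sub ht0
  have h2 := tendsto_nhds_unique (h1.comp hns.tendsto_atTop) hω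
  rwa [h2] at h1

/-! ### Drift of a quadratic form with momentum -/

/-- On a finite-dimensional space, a continuous function that is homogeneous of degree two is
bounded by a multiple of any positive one. -/
theorem exists_le_mul_of_homogeneous {E : Type*} [NormedAddCommGroup E] [NormedSpace ℝ E]
    [FiniteDimensional ℝ E] {q₁ q₂ : E → ℝ} (h₁ : Continuous q₁) (h₂ : Continuous q₂)
    (hom₁ : ∀ (t : ℝ) v, q₁ (t • v) = t ^ 2 * q₁ v) (hom₂ : ∀ (t : ℝ) v, q₂ (t • v) = t ^ 2 * q₂ v)
    (hpos : ∀ v, v ≠ 0 → 0 < q₁ v) : ∃ K, 0 < K ∧ ∀ v, q₂ v ≤ K * q₁ v := by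
  have : ProperSpace E := FiniteDimensional.proper ℝ E
  have hS : ∀ v ∈ Metric.sphere (0 : E) 1, 0 < q₁ v := fun v hv =>
    hpos v (by rintro rfl; simp at hv)
  have hcont : ContinuousOn (fun v => q₂ v / q₁ v) (Metric.sphere (0 : E) 1) :=
    h₂.continuousOn.div h₁.continuousOn fun v hv => (hS v hv).ne'
  obtain ⟨K, hK⟩ := (isCompact_sphere (0 : E) 1).bddAbove_image hcont
  -- The maximum keeps the constant positive even if the ratio is nonpositive or the sphere is
  -- empty.
  refine ⟨max K 1, by positivity, fun v => ?_⟩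
  rcases eq_or_ne v 0 with rfl | hv
  · have e₁ := hom₁ 0 0
    have e₂ := hom₂ 0 0
    simp only [smul_zero] at e₁ e₂
    rw [e₁, e₂]; simp
  have hn : 0 < ‖v‖ := norm_pos_iff.2 hv
  set u := ‖v‖⁻¹ • v with hu
  have hus : u ∈ Metric.sphere (0 : E) 1 := by simp [hu, norm_smul, hn.ne']
  have huv : v = ‖v‖ • u := by simp [hu, smul_smul, hn.ne']
  have h3 : q₂ u ≤ max K 1 * q₁ u :=
    (div_le_iff₀ (hS u hus)).1 ((hK ⟨u, hus, rfl⟩).trans (le_max_left _ _))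
  rw [huv, hom₁, hom₂]
  nlinarith [sq_nonneg ‖v‖]

/-- The drift of the Lyapunov function `B u u + ‖δ‖ ^ 2` under one step
`(u, δ) ↦ (u + α F, α F)` of a stochastic approximation scheme with momentum. -/
theorem exists_lyapunov_drift {E Ω : Type*} [NormedAddCommGroup E] [NormedSpace ℝ E]
    [FiniteDimensional ℝ E] [MeasurableSpace Ω] (μ : Measure Ω) [IsProbabilityMeasure μ]
    (B : E →L[ℝ] E →L[ℝ] ℝ) (hsymm : ∀ u v, B u v = B v u)
    {c K Q : ℝ} (hc : 0 < c) (hK : 0 ≤ K) (hQ : 0 ≤ Q) :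
    ∃ α₀ > 0, ∃ c' > 0, ∃ C ≥ 0, ∀ (u δ : E) (F : Ω → E) (q : Ω → ℝ) (α : ℝ),
      0 ≤ α → α ≤ α₀ → AEStronglyMeasurable F μ → Integrable q μ → ∫ ω, q ω ∂μ ≤ Q →
      (∀ ω, ‖F ω‖ ^ 2 ≤ K * (‖u‖ ^ 2 + ‖δ‖ ^ 2 + q ω)) →
      ∫ ω, B u (F ω) ∂μ ≤ - c * ‖u‖ ^ 2 + K * ‖δ‖ ^ 2 →
      Integrable (fun ω => B (u + α • F ω) (u + α • F ω) + ‖α • F ω‖ ^ 2) μ ∧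
        ∫ ω, (B (u + α • F ω) (u + α • F ω) + ‖α • F ω‖ ^ 2) ∂μ ≤
          (1 - c' * α) * (B u u + ‖δ‖ ^ 2) + C * α ^ 2 := by
  set b : ℝ := ‖B‖ with hb
  have hb0 : 0 ≤ b := norm_nonneg B
  have hBle : ∀ u v, ‖B u v‖ ≤ b * ‖u‖ * ‖v‖ := fun u v => B.le_opNorm₂ u v
  set K' := (b + 1) * K with hK'
  have hK'0 : 0 ≤ K' := by positivity
  set c' := c / (b + 1) with hc'
  have hc'0 : 0 < c' := by positivity
  have hc'b : c' * b ≤ c := by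
    rw [hc', div_mul_eq_mul_div, div_le_iff₀ (by positivity)]; nlinarith
  set L := 2 * K + K' + c' + 1 with hL
  have hL0 : 0 < L := by positivity
  -- The linear term supplies `-2 α c ‖u‖²`. The bound `α K' ≤ c` spends half of it on the
  -- second-order term; the other half gives the contraction, as `c' * B u u ≤ c * ‖u‖²`. The bound
  -- `α L ≤ 1` makes the total coefficient of the old `‖δ‖²` at most `1 - c' α`.
  refine ⟨min (c / (K' + 1)) (min (1 / L) 1), by positivity, c', hc'0, K' * Q, by positivity, ?_⟩
  intro u δ F q α hα hα₀ hF hq hqQ hFq hdrift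
  have hα1 : α * K' ≤ c := by
    have : α ≤ c / (K' + 1) := hα₀.trans (min_le_left _ _)
    rw [le_div_iff₀ (by positivity)] at this; nlinarith
  have hα2 : α * L ≤ 1 := by
    have : α ≤ 1 / L := hα₀.trans ((min_le_right _ _).trans (min_le_left _ _))
    rwa [le_div_iff₀ hL0] at this
  have hα3 : α ≤ 1 := hα₀.trans ((min_le_right _ _).trans (min_le_right _ _))
  have hdom : Integrable (fun ω => K * (‖u‖ ^ 2 + ‖δ‖ ^ 2 + q ω)) μ :=
    ((integrable_const _).add hq).const_mul K
  have hF2 : Integrable (fun ω => ‖F ω‖ ^ 2) μ := by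
    refine hdom.mono' (hF.norm.pow 2) (ae_of_all _ fun ω => ?_)
    rw [Real.norm_of_nonneg (by positivity)]
    exact hFq ω
  have hF1 : Integrable F μ := by
    refine (hF2.add (integrable_const 1)).mono' hF (ae_of_all _ fun ω => ?_)
    simp only [Pi.add_apply]; nlinarith [sq_nonneg (‖F ω‖ - 1), norm_nonneg (F ω)]
  have hBF : Integrable (fun ω => B u (F ω)) μ := (B u).integrable_comp hF1
  have hBFFm : AEStronglyMeasurable (fun ω => B (F ω) (F ω)) μ :=
    (show Continuous fun v => B v v by fun_prop).comp_aestronglyMeasurable hF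
  have hBFF : Integrable (fun ω => B (F ω) (F ω)) μ := by
    refine (hF2.const_mul b).mono' hBFFm (ae_of_all _ fun ω => ?_)
    have := hBle (F ω) (F ω); rw [sq]; linarith
  have hexp : ∀ ω, B (u + α • F ω) (u + α • F ω) + ‖α • F ω‖ ^ 2 =
      B u u + 2 * α * B u (F ω) + α ^ 2 * (B (F ω) (F ω) + ‖F ω‖ ^ 2) := fun ω => by
    simp only [map_add, map_smul, add_apply, smul_apply,
      smul_eq_mul, norm_smul, mul_pow, Real.norm_eq_abs, sq_abs]
    rw [hsymm (F ω) u]; ring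
  have hi1 : Integrable (fun ω => B u u + 2 * α * B u (F ω)) μ :=
    (integrable_const _).add (hBF.const_mul _)
  have hi2 : Integrable (fun ω => α ^ 2 * (B (F ω) (F ω) + ‖F ω‖ ^ 2)) μ :=
    (hBFF.add hF2).const_mul _
  simp only [hexp]
  refine ⟨hi1.add hi2, ?_⟩
  rw [integral_add hi1 hi2, integral_add (integrable_const _) (hBF.const_mul _),
    integral_const_mul, integral_const_mul]
  have h2 : ∫ ω, (B (F ω) (F ω) + ‖F ω‖ ^ 2) ∂μ ≤ K' * (‖u‖ ^ 2 + ‖δ‖ ^ 2 + Q) := by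
    calc ∫ ω, (B (F ω) (F ω) + ‖F ω‖ ^ 2) ∂μ
        ≤ ∫ ω, K' * (‖u‖ ^ 2 + ‖δ‖ ^ 2 + q ω) ∂μ := by
          refine integral_mono (hBFF.add hF2) (((integrable_const _).add hq).const_mul K')
            fun ω => ?_
          have e1 := (le_abs_self _).trans (hBle (F ω) (F ω))
          have e2 := mul_le_mul_of_nonneg_left (hFq ω) (show 0 ≤ b + 1 by positivity)
          simp only [hK']; nlinarith
      _ = K' * (‖u‖ ^ 2 + ‖δ‖ ^ 2 + ∫ ω, q ω ∂μ) := by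
          rw [integral_const_mul, integral_add (integrable_const _) hq]; simp
      _ ≤ _ := by gcongr
  simp only [integral_const, probReal_univ, one_smul]
  have h3 := mul_le_mul_of_nonneg_left h2 (sq_nonneg α)
  have h4 := mul_le_mul_of_nonneg_left hdrift (show 0 ≤ 2 * α by positivity)
  have h5 : B u u ≤ b * ‖u‖ ^ 2 := by
    have := (le_abs_self _).trans (hBle u u); rw [sq]; linarith
  have h6 : c' * B u u ≤ c * ‖u‖ ^ 2 := by
    calc c' * B u u ≤ c' * (b * ‖u‖ ^ 2) := by gcongr
      _ = (c' * b) * ‖u‖ ^ 2 := by ring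
      _ ≤ _ := by gcongr
  have h7 := mul_le_mul_of_nonneg_left h6 hα
  have h8 : α ^ 2 * K' * ‖u‖ ^ 2 ≤ α * c * ‖u‖ ^ 2 := by
    have := mul_le_mul_of_nonneg_left hα1 hα
    have := mul_le_mul_of_nonneg_right this (sq_nonneg ‖u‖)
    linarith
  have h9 : (2 * α * K + α ^ 2 * K') * ‖δ‖ ^ 2 ≤ (1 - c' * α) * ‖δ‖ ^ 2 := by
    refine mul_le_mul_of_nonneg_right ?_ (sq_nonneg _)
    have : α ^ 2 * K' ≤ α * K' := by
      refine mul_le_mul_of_nonneg_right ?_ hK'0; nlinarith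
    rw [hL] at hα2; nlinarith
  nlinarith

/-! ### Affine dependence on the starting point -/

/-- If the affine maps `T n` send every point of a basis, and the origin, to sequences that tend
to zero, they do so for every point. -/
theorem tendsto_zero_of_basis {E ι : Type*} [NormedAddCommGroup E] [NormedSpace ℝ E]
    (v : Module.Basis ι ℝ E) {T : ℕ → E → E}
    (hT : ∀ n (t : ℝ) (x y : E), T n (x + t • y) = T n x + t • (T n y - T n 0))
    (h0 : Tendsto (fun n => T n 0) atTop (𝓝 0))
    (hv : ∀ i, Tendsto (fun n => T n (v i)) atTop (𝓝 0)) (x : E) :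
    Tendsto (fun n => T n x) atTop (𝓝 0) := by
  have key : ∀ (t : ℝ) {x y : E}, Tendsto (fun n => T n x) atTop (𝓝 0) →
      Tendsto (fun n => T n y) atTop (𝓝 0) → Tendsto (fun n => T n (x + t • y)) atTop (𝓝 0) := by
    intro t x y hx hy
    simp only [hT]
    simpa using hx.add ((hy.sub h0).const_smul t)
  let P : Submodule ℝ E :=
    { carrier := {x | Tendsto (fun n => T n x) atTop (𝓝 0)}
      zero_mem' := h0
      add_mem' := fun {x y} hx hy => by simpa using key 1 hx hy
      smul_mem' := fun t x hx => by simpa using key t h0 hx }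
  have hP : P = ⊤ := by
    rw [eq_top_iff, ← v.span_eq, Submodule.span_le]
    rintro _ ⟨i, rfl⟩
    exact hv i
  have : x ∈ P := hP ▸ Submodule.mem_top
  exact this

/-- The trajectories of the recursion `z (n+1) = Φ n (z n) (y n)`. -/
def trajectory {Z 𝒴 : Type*} (Φ : ℕ → Z → 𝒴 → Z) (y : ℕ → 𝒴) : ℕ → Z → Z
  | 0, z => z
  | n + 1, z => Φ n (trajectory Φ y n z) (y n)

theorem trajectory_affine {Z 𝒴 : Type*} [AddCommGroup Z] [Module ℝ Z] {Φ : ℕ → Z → 𝒴 → Z}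
    (hΦ : ∀ n y (t : ℝ) (x x' x'' : Z),
      Φ n (x + t • (x' - x'')) y = Φ n x y + t • (Φ n x' y - Φ n x'' y))
    (y : ℕ → 𝒴) (n : ℕ) (t : ℝ) (x x' : Z) :
    trajectory Φ y n (x + t • x') =
      trajectory Φ y n x + t • (trajectory Φ y n x' - trajectory Φ y n 0) := by
  induction n with
  | zero => simp [trajectory]
  | succ n ih => simp only [trajectory, ih, hΦ]

/-! ### Feature matrices and the TD fixed point -/

theorem PMF.sum_toReal {T : Type*} [Fintype T] (q : PMF T) : ∑ t, (q t).toReal = 1 := by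
  rw [← ENNReal.toReal_sum fun t _ => q.apply_ne_top t, ← tsum_fintype (L := .unconditional T), q.tsum_coe,
    ENNReal.toReal_one]

section Features

variable {S A : Type*} [Fintype S] [DecidableEq S] [Fintype A] {M : MDP S A} {b : S → PMF A}
  {d : PMF S} {p : ℕ} (x : S → Fin p → ℝ)

/-- The matrix `E (x_n - γ x_{n+1}) x_nᵀ`. -/
noncomputable def tdMatrix (M : MDP S A) (b : S → PMF A) (γ : ℝ) (x : S → Fin p → ℝ) (d : PMF S) :
    Matrix (Fin p) (Fin p) ℝ :=
  (featureMatrix x - γ • (M.transitionMatrix b * featureMatrix x))ᵀ * stateWeights d *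
    featureMatrix x

/-- The matrix `E x_n x_nᵀ`. -/
noncomputable def featureCov (x : S → Fin p → ℝ) (d : PMF S) : Matrix (Fin p) (Fin p) ℝ :=
  (featureMatrix x)ᵀ * stateWeights d * featureMatrix x

theorem featureCov_apply (d : PMF S) (i j : Fin p) :
    featureCov x d i j = ∑ t, x t i * (d t).toReal * x t j := by
  simp [featureCov, Matrix.mul_apply, stateWeights, featureMatrix, Matrix.diagonal]

theorem tdMatrix_apply (γ : ℝ) (i j : Fin p) :
    tdMatrix M b γ x d i j =
      ∑ t, (x t i - γ * ∑ u, M.transitionMatrix b t u * x u i) * (d t).toReal * x t j := by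
  simp [tdMatrix, Matrix.mul_apply, stateWeights, featureMatrix, Matrix.diagonal, mul_comm]

/-- The form is the `d`-weighted sum of squares of the entries of `X v`. If it vanishes, then `D X v
= 0`, so `C v = 0`, against invertibility. States of weight zero do no harm. -/
theorem featureCov_pos (hdet : IsUnit (featureCov x d).det) {v : Fin p → ℝ} (hv : v ≠ 0) :
    0 < v ⬝ᵥ featureCov x d *ᵥ v := by
  have hD : featureCov x d *ᵥ v =
      (featureMatrix x)ᵀ *ᵥ (fun t => (d t).toReal * (featureMatrix x *ᵥ v) t) := by
    rw [featureCov, ← Matrix.mulVec_mulVec, ← Matrix.mulVec_mulVec]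
    congr 1; ext t; simp [stateWeights, Matrix.mulVec_diagonal]
  have hq : v ⬝ᵥ featureCov x d *ᵥ v = ∑ t, (d t).toReal * (featureMatrix x *ᵥ v) t ^ 2 := by
    rw [hD, Matrix.dotProduct_mulVec, Matrix.vecMul_transpose]
    exact Finset.sum_congr rfl fun t _ => by ring
  have hnn : ∀ t ∈ Finset.univ, 0 ≤ (d t).toReal * (featureMatrix x *ᵥ v) t ^ 2 :=
    fun t _ => by positivity
  rw [hq]
  refine lt_of_le_of_ne (Finset.sum_nonneg hnn) fun h0 => hv ?_
  have hz := (Finset.sum_eq_zero_iff_of_nonneg hnn).1 h0.symm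
  have hCv : featureCov x d *ᵥ v = 0 := by
    rw [hD, show (fun t => (d t).toReal * (featureMatrix x *ᵥ v) t) = 0 from ?_, Matrix.mulVec_zero]
    ext t
    rcases mul_eq_zero.1 (hz t (Finset.mem_univ t)) with h | h
    · simp [h]
    · simp [pow_eq_zero_iff] at h; simp [h]
  exact Matrix.eq_zero_of_mulVec_eq_zero hdet.ne_zero hCv

/-- The TD fixed points are the solutions of a linear system. -/
theorem isTDFixedPoint_iff (hdet : IsUnit (featureCov x d).det) (γ : ℝ) (w : Fin p → ℝ) :
    IsTDFixedPoint M b γ x d w ↔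
      (tdMatrix M b γ x d)ᵀ *ᵥ w = ((featureMatrix x)ᵀ * stateWeights d) *ᵥ M.rewardVector b := by
  set X := featureMatrix x with hX
  set N := Xᵀ * stateWeights d with hN
  set V := M.bellman b γ (X *ᵥ w) with hV
  have hC : featureCov x d = N * X := rfl
  have hA : (tdMatrix M b γ x d)ᵀ *ᵥ w = (N * X) *ᵥ w - γ • (N *ᵥ (M.transitionMatrix b *ᵥ (X *ᵥ w))) := by
    have hDt : (stateWeights d)ᵀ = stateWeights d := Matrix.diagonal_transpose _
    simp only [tdMatrix, Matrix.transpose_mul, Matrix.transpose_transpose, hDt, ← hX, hN]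
    rw [← Matrix.mul_assoc, Matrix.mul_sub, Matrix.sub_mulVec, Matrix.mul_smul, Matrix.smul_mulVec]
    simp only [Matrix.mulVec_mulVec, Matrix.mul_assoc]
  have hNV : N *ᵥ V = N *ᵥ M.rewardVector b +
      γ • (N *ᵥ (M.transitionMatrix b *ᵥ (X *ᵥ w))) := by
    rw [hV, MDP.bellman, Matrix.mulVec_add, Matrix.mulVec_smul]
  have hproj : projection x d *ᵥ V = X *ᵥ ((N * X)⁻¹ *ᵥ (N *ᵥ V)) := by
    simp only [projection, Matrix.mulVec_mulVec, hN, hX, Matrix.mul_assoc]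
  rw [hC] at hdet
  -- Multiplication by `N = XᵀD` cancels the inverse inside the projection; conversely, `(N X)⁻¹`
  -- recovers `w` from the normal equation.
  have step : IsTDFixedPoint M b γ x d w ↔ (N * X) *ᵥ w = N *ᵥ V := by
    rw [IsTDFixedPoint, approxValue, ← hX, ← hV, hproj]
    constructor
    · intro h
      have := congrArg (fun u => N *ᵥ u) h
      simp only [Matrix.mulVec_mulVec] at this ⊢
      rwa [← Matrix.mul_assoc, ← Matrix.mul_assoc, Matrix.mul_nonsing_inv _ hdet,
        Matrix.one_mul] at this
    · intro h
      rw [← h, Matrix.mulVec_mulVec w, Matrix.nonsing_inv_mul _ hdet, Matrix.one_mulVec]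
  rw [step, hNV, hA, sub_eq_iff_eq_add]

end Features

/-! ### Expectations under the transition law -/

section TransitionLaw

variable {S A Ω : Type*} [Fintype S] [MeasurableSpace S]
  [DiscreteMeasurableSpace S] [Fintype A] [MeasurableSpace A] [DiscreteMeasurableSpace A]
  [MeasurableSpace Ω] {μ : Measure Ω}
  {M : MDP S A} {b : S → PMF A} {d : PMF S} {s : Ω → S} {a : Ω → A} {r : Ω → ℝ} {s' : Ω → S}

/-- Expectations of products of a function of the states and a function of the reward. -/
theorem HasTransitionLaw.integral_mul_eq (h : HasTransitionLaw M b d μ s a r s')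
    (hs : Measurable s) (ha : Measurable a) (hr : Measurable r) (hs' : Measurable s')
    (g : S → S → ℝ) {ψ : ℝ → ℝ} (hψ : Measurable ψ) (hint : Integrable (fun ω => ψ (r ω)) μ) :
    ∫ ω, g (s ω) (s' ω) * ψ (r ω) ∂μ =
      ∑ i, ∑ k, ∑ j, (d i).toReal * (b i k).toReal * (M.trans i k j).toReal *
        (g i j * ∫ y, ψ y ∂(M.reward i k j : Measure ℝ)) := by
  classical
  -- The cells of fixed state, action and successor partition `Ω`; on each, the reward has the law
  -- prescribed by `M`, scaled by the probability of the cell.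
  set T : S → A → S → Set Ω := fun i k j => {ω | s ω = i ∧ a ω = k ∧ s' ω = j} with hT
  have hTm : ∀ i k j, MeasurableSet (T i k j) := fun i k j =>
    (hs (measurableSet_singleton i)).inter
      ((ha (measurableSet_singleton k)).inter (hs' (measurableSet_singleton j)))
  have hmap : ∀ i k j, (μ.restrict (T i k j)).map r =
      (d i * b i k * M.trans i k j) • (M.reward i k j : Measure ℝ) := fun i k j => by
    ext B hB
    rw [Measure.map_apply hr hB, Measure.restrict_apply (hr hB), Measure.smul_apply, smul_eq_mul,
      ← h i k j B hB]
    congr 1; ext ω; simp [hT]; tauto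
  have hdecomp : ∀ ω, g (s ω) (s' ω) * ψ (r ω) =
      ∑ i, ∑ k, ∑ j, (T i k j).indicator (fun ω => g i j * ψ (r ω)) ω := fun ω => by
    rw [Finset.sum_eq_single (s ω), Finset.sum_eq_single (a ω), Finset.sum_eq_single (s' ω)]
    · simp [hT]
    · intro j _ hj; simp [hT, hj.symm]
    · simp
    · intro k _ hk; simp [hT, hk.symm]
    · simp
    · intro i _ hi; simp [hT, hi.symm]
    · simp
  have hI : ∀ i k j, Integrable ((T i k j).indicator (fun ω => g i j * ψ (r ω))) μ :=
    fun i k j => (hint.const_mul _).indicator (hTm i k j)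
  simp only [hdecomp]
  rw [integral_finsetSum _ fun i _ => integrable_finsetSum _ fun k _ =>
    integrable_finsetSum _ fun j _ => hI i k j]
  refine Finset.sum_congr rfl fun i _ => ?_
  rw [integral_finsetSum _ fun k _ => integrable_finsetSum _ fun j _ => hI i k j]
  refine Finset.sum_congr rfl fun k _ => ?_
  rw [integral_finsetSum _ fun j _ => hI i k j]
  refine Finset.sum_congr rfl fun j _ => ?_
  rw [integral_indicator (hTm i k j), integral_const_mul,
    ← integral_map hr.aemeasurable hψ.aestronglyMeasurable, hmap, integral_smul_measure]
  simp only [ENNReal.toReal_mul, smul_eq_mul]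
  ring

theorem HasTransitionLaw.integral_reward_mul_eq (h : HasTransitionLaw M b d μ s a r s')
    (hs : Measurable s) (ha : Measurable a) (hr : Measurable r) (hs' : Measurable s')
    (hint : Integrable r μ) (f : S → ℝ) :
    ∫ ω, r ω * f (s ω) ∂μ = ∑ i, f i * (d i).toReal * M.rewardVector b i := by
  have h1 := h.integral_mul_eq hs ha hr hs' (fun i _ => f i) measurable_id hint
  simp only [id] at h1
  rw [show (fun ω => r ω * f (s ω)) = fun ω => f (s ω) * r ω from funext fun _ => mul_comm _ _, h1]
  refine Finset.sum_congr rfl fun i _ => ?_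
  simp only [MDP.rewardVector, Finset.mul_sum]
  exact Finset.sum_congr rfl fun k _ => Finset.sum_congr rfl fun j _ => by ring

variable [IsProbabilityMeasure μ]

/-- With the reward factor set to `1`, summing out the action and successor leaves total mass one
for `f i` and a row of `P` for `f j`. The case `γ = 0` yields the feature covariance. -/
theorem HasTransitionLaw.integral_states_eq (h : HasTransitionLaw M b d μ s a r s')
    (hs : Measurable s) (ha : Measurable a) (hr : Measurable r) (hs' : Measurable s')
    (f g : S → ℝ) (γ : ℝ) :
    ∫ ω, (f (s ω) - γ * f (s' ω)) * g (s ω) ∂μ =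
      ∑ i, (f i - γ * ∑ j, M.transitionMatrix b i j * f j) * (d i).toReal * g i := by
  have h1 := h.integral_mul_eq hs ha hr hs' (fun i j => (f i - γ * f j) * g i)
    (ψ := fun _ => 1) measurable_const (integrable_const _)
  simp only [mul_one, integral_const, probReal_univ, one_smul] at h1
  rw [h1]
  refine Finset.sum_congr rfl fun i _ => ?_
  have e1 : ∑ k, ∑ j, (b i k).toReal * (M.trans i k j).toReal = 1 := by
    simp [← Finset.mul_sum, PMF.sum_toReal]
  have e2 : ∑ j, M.transitionMatrix b i j * f j =
      ∑ k, ∑ j, (b i k).toReal * (M.trans i k j).toReal * f j := by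
    rw [Finset.sum_comm]
    simp [MDP.transitionMatrix, Finset.sum_mul]
  rw [e2]
  calc ∑ k, ∑ j, (d i).toReal * (b i k).toReal * (M.trans i k j).toReal *
        ((f i - γ * f j) * g i)
      = (d i).toReal * g i * (f i * ∑ k, ∑ j, (b i k).toReal * (M.trans i k j).toReal -
          γ * ∑ k, ∑ j, (b i k).toReal * (M.trans i k j).toReal * f j) := by
        simp only [Finset.mul_sum, ← Finset.sum_sub_distrib]
        exact Finset.sum_congr rfl fun k _ => Finset.sum_congr rfl fun j _ => by ring
    _ = _ := by rw [e1]; ring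

variable [DecidableEq S] {p : ℕ} (x : S → Fin p → ℝ)

theorem HasTransitionLaw.integral_td_eq (h : HasTransitionLaw M b d μ s a r s')
    (hs : Measurable s) (ha : Measurable a) (hr : Measurable r) (hs' : Measurable s') (γ : ℝ)
    (i j : Fin p) :
    ∫ ω, (x (s ω) i - γ * x (s' ω) i) * x (s ω) j ∂μ = tdMatrix M b γ x d i j := by
  rw [tdMatrix_apply]
  exact h.integral_states_eq hs ha hr hs' (fun t => x t i) (fun t => x t j) γ

theorem HasTransitionLaw.integral_cov_eq (h : HasTransitionLaw M b d μ s a r s')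
    (hs : Measurable s) (ha : Measurable a) (hr : Measurable r) (hs' : Measurable s')
    (i j : Fin p) :
    ∫ ω, x (s ω) i * x (s ω) j ∂μ = featureCov x d i j := by
  rw [featureCov_apply]
  simpa using h.integral_states_eq hs ha hr hs' (fun t => x t i) (fun t => x t j) 0

end TransitionLaw

/-! ### The Lyapunov form -/

/-- A Lyapunov form for the mean matrix `G` of the iteration: its drift under `u' = -G u` is
strictly negative. -/
theorem exists_lyapunov_form {p : ℕ} {C A : Matrix (Fin p) (Fin p) ℝ}
    (hC : ∀ v : Fin p → ℝ, v ≠ 0 → 0 < v ⬝ᵥ C *ᵥ v) (hA : IsUnit A.det) :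
    ∃ B : Param p →L[ℝ] Param p →L[ℝ] ℝ, (∀ u v, B u v = B v u) ∧ (∀ u, u ≠ 0 → 0 < B u u) ∧
      ∀ u, u ≠ 0 → 0 < B u (Matrix.fromBlocks C Aᵀ (-A) 0 *ᵥ u) := by
  have hsq : ∀ v : Fin p → ℝ, 0 ≤ v ⬝ᵥ v := fun v =>
    Finset.sum_nonneg fun i _ => mul_self_nonneg _
  have hsq' : ∀ v : Fin p → ℝ, v ≠ 0 → 0 < v ⬝ᵥ v := fun v hv =>
    lt_of_le_of_ne (hsq v) fun h => hv (dotProduct_self_eq_zero.1 h.symm)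
  have hcross : ∀ v w : Fin p → ℝ, -(v ⬝ᵥ v + w ⬝ᵥ w) ≤ 2 * (v ⬝ᵥ w) := fun v w => by
    have := hsq (v + w)
    simp only [dotProduct_add, add_dotProduct, dotProduct_comm w v] at this
    linarith
  obtain ⟨K, hK, hKle⟩ := exists_le_mul_of_homogeneous (q₁ := fun v => v ⬝ᵥ C *ᵥ v)
    (q₂ := fun v => A *ᵥ v ⬝ᵥ A *ᵥ v + C *ᵥ v ⬝ᵥ C *ᵥ v) (by fun_prop) (by fun_prop)
    (fun t v => by simp [Matrix.mulVec_smul]; ring) (fun t v => by simp [Matrix.mulVec_smul]; ring)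
    hC
  obtain ⟨K₁, hK₁, hKle₁⟩ := exists_le_mul_of_homogeneous (q₁ := fun v : Fin p → ℝ => v ⬝ᵥ v)
    (q₂ := fun v => Aᵀ *ᵥ v ⬝ᵥ Aᵀ *ᵥ v) (by fun_prop) (by fun_prop)
    (fun t v => by simp; ring) (fun t v => by simp [Matrix.mulVec_smul]; ring) hsq'
  -- This makes each of `ε`, `ε K` and `ε K₁` smaller than `1 / 2`: `ε` and `ε K₁` keep the form
  -- positive, `ε K` keeps its drift positive.
  set ε : ℝ := 1 / (2 * (1 + K + K₁)) with hε
  have hε0 : 0 < ε := by positivity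
  have hεe : ε * (1 + K + K₁) = 1 / 2 := by rw [hε]; field_simp
  have hεK : 0 < ε * K := by positivity
  have hεK₁ : 0 < ε * K₁ := by positivity
  let B : Param p →L[ℝ] Param p →L[ℝ] ℝ := LinearMap.toContinuousBilinearMap
    (Matrix.toLinearMap₂' ℝ (Matrix.fromBlocks 1 (ε • Aᵀ) (ε • A) 1))
  have hBapply : ∀ (η w η' w' : Fin p → ℝ), B (Sum.elim η w) (Sum.elim η' w') =
      η ⬝ᵥ η' + w ⬝ᵥ w' + ε * (η ⬝ᵥ Aᵀ *ᵥ w' + η' ⬝ᵥ Aᵀ *ᵥ w) := fun η w η' w' => by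
    have h1 : B (Sum.elim η w) (Sum.elim η' w') =
      Sum.elim η w ⬝ᵥ Matrix.fromBlocks 1 (ε • Aᵀ) (ε • A) 1 *ᵥ Sum.elim η' w' :=
        Matrix.toLinearMap₂'_apply' _ _ _
    have h2 : w ⬝ᵥ A *ᵥ η' = η' ⬝ᵥ Aᵀ *ᵥ w := by
      rw [Matrix.dotProduct_mulVec, ← Matrix.mulVec_transpose, dotProduct_comm]
    rw [h1, Matrix.fromBlocks_mulVec, sumElim_dotProduct_sumElim]
    simp only [Sum.elim_comp_inl, Sum.elim_comp_inr, Matrix.one_mulVec, Matrix.smul_mulVec,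
      dotProduct_add, dotProduct_smul, smul_eq_mul, h2]
    ring
  have hsplit : ∀ u : Param p, ∃ η w : Fin p → ℝ, u = Sum.elim η w := fun u =>
    ⟨u ∘ Sum.inl, u ∘ Sum.inr, (Sum.elim_comp_inl_inr u).symm⟩
  refine ⟨B, fun u v => ?_, fun u hu => ?_, fun u hu => ?_⟩
  · obtain ⟨η, w, rfl⟩ := hsplit u
    obtain ⟨η', w', rfl⟩ := hsplit v
    rw [hBapply, hBapply, dotProduct_comm η, dotProduct_comm w]
    ring
  · obtain ⟨η, w, rfl⟩ := hsplit u
    rw [hBapply]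
    have h1 := mul_le_mul_of_nonneg_left (hcross η (Aᵀ *ᵥ w)) hε0.le
    have h2 := mul_le_mul_of_nonneg_left (hKle₁ w) hε0.le
    have h3 := hsq η
    have h4 := hsq w
    have h5 : 0 < η ⬝ᵥ η + w ⬝ᵥ w := by
      by_cases hη : η = 0
      · have hw : w ≠ 0 := by
          rintro rfl; subst hη; exact hu (by ext (i | i) <;> rfl)
        have := hsq' w hw; linarith
      · have := hsq' η hη; linarith
    nlinarith
  · obtain ⟨η, w, rfl⟩ := hsplit u
    rw [Matrix.fromBlocks_mulVec]
    simp only [Sum.elim_comp_inl, Sum.elim_comp_inr, Matrix.zero_mulVec, add_zero]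
    rw [hBapply]
    have e1 : η ⬝ᵥ Aᵀ *ᵥ (-A *ᵥ η) = -(A *ᵥ η ⬝ᵥ A *ᵥ η) := by
      rw [Matrix.neg_mulVec, Matrix.mulVec_neg, dotProduct_neg, Matrix.dotProduct_mulVec,
        Matrix.vecMul_transpose]
    have e2 : w ⬝ᵥ (-A *ᵥ η) = -(η ⬝ᵥ Aᵀ *ᵥ w) := by
      rw [Matrix.neg_mulVec, dotProduct_neg, Matrix.dotProduct_mulVec, ← Matrix.mulVec_transpose,
        dotProduct_comm]
    rw [e1, e2, dotProduct_add, add_dotProduct]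
    -- The skew blocks have cancelled, leaving `η · C η + ε (|Aᵀ w|² + C η · Aᵀ w - |A η|²)`. Half
    -- of `|Aᵀ w|²` pays for the mixed product; the terms in `A η` and `C η` are at most `ε K (η · C
    -- η)`.
    have h1 := mul_le_mul_of_nonneg_left (hcross (C *ᵥ η) (Aᵀ *ᵥ w)) hε0.le
    have h2 := mul_le_mul_of_nonneg_left (hKle η) hε0.le
    have h3 := hsq (C *ᵥ η)
    have h3' := mul_nonneg hε0.le h3
    have h4 := mul_nonneg hε0.le (hsq (Aᵀ *ᵥ w))
    by_cases hη : η = 0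
    · have hw : w ≠ 0 := by
        rintro rfl; subst hη; exact hu (by ext (i | i) <;> rfl)
      have hAw : Aᵀ *ᵥ w ≠ 0 := fun h => hw
        (Matrix.eq_zero_of_mulVec_eq_zero (by rw [Matrix.det_transpose]; exact hA.ne_zero) h)
      have := mul_pos hε0 (hsq' _ hAw)
      subst hη
      simpa using this
    · have h5 := hC η hη
      have h6 : ε * K * (η ⬝ᵥ C *ᵥ η) ≤ 1 / 2 * (η ⬝ᵥ C *ᵥ η) :=
        mul_le_mul_of_nonneg_right (by nlinarith) h5.le
      nlinarith

/-! ### Means of the sampled matrices and vectors -/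

section SampleMeans

variable {S A Ω : Type*} [Fintype S] [DecidableEq S] [MeasurableSpace S]
  [DiscreteMeasurableSpace S] [Fintype A] [MeasurableSpace A] [DiscreteMeasurableSpace A]
  [MeasurableSpace Ω] {μ : Measure Ω} [IsProbabilityMeasure μ]
  {M : MDP S A} {b : S → PMF A} {d : PMF S} {s : Ω → S} {a : Ω → A} {r : Ω → ℝ} {s' : Ω → S}
  {p : ℕ} (x : S → Fin p → ℝ)

theorem HasTransitionLaw.expMatrix_sampleG (h : HasTransitionLaw M b d μ s a r s')
    (hs : Measurable s) (ha : Measurable a) (hr : Measurable r) (hs' : Measurable s') (γ : ℝ) :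
    expMatrix μ (fun ω => sampleG γ (x (s ω)) (x (s' ω))) =
      Matrix.fromBlocks (featureCov x d) (tdMatrix M b γ x d)ᵀ (-tdMatrix M b γ x d) 0 := by
  ext i j
  rcases i with i | i <;> rcases j with j | j
  · simpa [expMatrix, sampleG, Matrix.vecMulVec_apply] using
      h.integral_cov_eq x hs ha hr hs' i j
  · have := h.integral_td_eq x hs ha hr hs' γ j i
    simp only [expMatrix, sampleG, Matrix.vecMulVec_apply, Matrix.of_apply,
      Matrix.fromBlocks_apply₁₂, Matrix.transpose_apply, Pi.sub_apply, Pi.smul_apply, smul_eq_mul]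
    simpa only [mul_comm (x (s _) i)] using this
  · have := h.integral_td_eq x hs ha hr hs' γ i j
    simp only [expMatrix, sampleG, Matrix.vecMulVec_apply, Matrix.of_apply, Matrix.neg_apply,
      Matrix.fromBlocks_apply₂₁, Pi.sub_apply, Pi.smul_apply, smul_eq_mul, integral_neg]
    rw [this]
  · simp [expMatrix, sampleG]

theorem HasTransitionLaw.expMatrix_sampleH (h : HasTransitionLaw M b d μ s a r s')
    (hs : Measurable s) (ha : Measurable a) (hr : Measurable r) (hs' : Measurable s') :
    expMatrix μ (fun ω => sampleH (x (s ω))) = Matrix.fromBlocks 0 0 0 (featureCov x d) := by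
  ext i j
  rcases i with i | i <;> rcases j with j | j
  · simp [expMatrix, sampleH]
  · simp [expMatrix, sampleH]
  · simp [expMatrix, sampleH]
  · simpa [expMatrix, sampleH, Matrix.vecMulVec_apply] using
      h.integral_cov_eq x hs ha hr hs' i j

theorem HasTransitionLaw.integral_sampleg (h : HasTransitionLaw M b d μ s a r s')
    (hs : Measurable s) (ha : Measurable a) (hr : Measurable r) (hs' : Measurable s')
    (hint : Integrable r μ) :
    Integrable (fun ω => sampleg (r ω) (x (s ω))) μ ∧ ∫ ω, sampleg (r ω) (x (s ω)) ∂μ =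
      Sum.elim (((featureMatrix x)ᵀ * stateWeights d) *ᵥ M.rewardVector b) 0 := by
  have hi : ∀ i, Integrable (fun ω => sampleg (r ω) (x (s ω)) i) μ := by
    rintro (i | i)
    · simp only [sampleg, Sum.elim_inl, Pi.smul_apply, smul_eq_mul]
      have hm : Measurable fun ω => x (s ω) i := (measurable_of_finite fun t => x t i).comp hs
      refine hint.mul_bdd (c := ∑ t, ‖x t i‖) hm.aestronglyMeasurable (ae_of_all _ fun ω => ?_)
      exact Finset.single_le_sum (f := fun t => ‖x t i‖) (fun _ _ => norm_nonneg _)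
        (Finset.mem_univ (s ω))
    · simp [sampleg]
  refine ⟨Integrable.of_eval hi, ?_⟩
  ext i
  rw [eval_integral hi]
  rcases i with i | i
  · simp only [sampleg, Sum.elim_inl, Pi.smul_apply, smul_eq_mul]
    rw [h.integral_reward_mul_eq hs ha hr hs' hint fun t => x t i]
    simp [Matrix.mulVec, dotProduct, featureMatrix, stateWeights]
  · simp [sampleg]

omit [IsProbabilityMeasure μ] in
theorem integrable_mulVec {m n : Type*} [Fintype m] [Fintype n] {F : Ω → Matrix m n ℝ}
    (hF : ∀ i j, Integrable (fun ω => F ω i j) μ) (v : n → ℝ) :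
    Integrable (fun ω => F ω *ᵥ v) μ ∧ ∫ ω, F ω *ᵥ v ∂μ = expMatrix μ F *ᵥ v := by
  have hi : ∀ i, Integrable (fun ω => (F ω *ᵥ v) i) μ := fun i =>
    integrable_finsetSum _ fun j _ => (hF i j).mul_const _
  refine ⟨Integrable.of_eval hi, ?_⟩
  ext i
  rw [eval_integral hi]
  simp only [Matrix.mulVec, dotProduct, expMatrix, Matrix.of_apply]
  rw [integral_finsetSum _ fun j _ => (hF i j).mul_const _]
  simp only [integral_mul_const]

omit [DecidableEq S] in
theorem integrable_comp_states (hs : Measurable s) (hs' : Measurable s') (g : S → S → ℝ) :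
    Integrable (fun ω => g (s ω) (s' ω)) μ := by
  have : Integrable (fun q : S × S => g q.1 q.2) (μ.map fun ω => (s ω, s' ω)) :=
    Integrable.of_finite
  exact this.comp_measurable (hs.prodMk hs')

end SampleMeans

/-! ### The centred iteration -/

/-- The direction of the update of the centred iterate `u = ρ - ρ⋆`, with previous
increment `δ`, from the sample `y = (x_n, r_n, x_{n+1})`. -/
noncomputable def centredDirection {p : ℕ} (γ κ : ℝ) (ρstar u δ : Param p)
    (y : (Fin p → ℝ) × ℝ × (Fin p → ℝ)) : Param p :=
  -(κ • (sampleH y.1 *ᵥ δ)) - sampleG γ y.1 y.2.2 *ᵥ u +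
    (sampleg y.2.1 y.1 - sampleG γ y.1 y.2.2 *ᵥ ρstar)

/-- One step of the iteration for the pair of the centred iterate and the increment. -/
noncomputable def centredStep {p : ℕ} (γ κ : ℝ) (ρstar : Param p) (α : ℝ)
    (z : Param p × Param p) (y : (Fin p → ℝ) × ℝ × (Fin p → ℝ)) : Param p × Param p :=
  (z.1 + α • centredDirection γ κ ρstar z.1 z.2 y, α • centredDirection γ κ ρstar z.1 z.2 y)

section CentredStep

variable {p : ℕ} (γ κ : ℝ) (ρstar : Param p)

/-- Keeping the increment as a second coordinate turns the two-step recursion into a one-step chain,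
to which the Lyapunov criterion applies. -/
theorem centredStep_sub (α r : ℝ) (y y' : Fin p → ℝ) (ρ ρ' : Param p) :
    centredStep γ κ ρstar α (ρ - ρstar, ρ - ρ') (y, r, y') =
      (gradientDDStep γ κ α r y y' ρ ρ' - ρstar, gradientDDStep γ κ α r y y' ρ ρ' - ρ) := by
  simp only [centredStep, centredDirection, gradientDDStep, Matrix.mulVec_sub]
  refine Prod.ext ?_ ?_ <;> simp only <;> module

theorem centredStep_affine (α : ℝ) (y : (Fin p → ℝ) × ℝ × (Fin p → ℝ)) (t : ℝ)
    (z z' z'' : Param p × Param p) :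
    centredStep γ κ ρstar α (z + t • (z' - z'')) y = centredStep γ κ ρstar α z y +
      t • (centredStep γ κ ρstar α z' y - centredStep γ κ ρstar α z'' y) := by
  simp only [centredStep, centredDirection, Prod.fst_add, Prod.snd_add, Prod.smul_fst,
    Prod.smul_snd, Prod.fst_sub, Prod.snd_sub, Matrix.mulVec_add, Matrix.mulVec_smul,
    Matrix.mulVec_sub]
  refine Prod.ext ?_ ?_ <;>
    simp only [Prod.fst_add, Prod.snd_add, Prod.smul_fst, Prod.smul_snd, Prod.fst_sub,
      Prod.snd_sub] <;> module

theorem continuous_sampleg : Continuous fun q : ℝ × (Fin p → ℝ) => sampleg q.1 q.2 := by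
  refine continuous_pi fun i => ?_
  rcases i with i | i
  · simp only [sampleg, Sum.elim_inl]; fun_prop
  · simp only [sampleg, Sum.elim_inr, Pi.zero_apply]; fun_prop

theorem continuous_centredDirection : Continuous
    fun q : (Param p × Param p) × ((Fin p → ℝ) × ℝ × (Fin p → ℝ)) =>
      centredDirection γ κ ρstar q.1.1 q.1.2 q.2 := by
  have h1 := continuous_sampleg (p := p)
  have h2 : Continuous fun q : (Param p × Param p) × ((Fin p → ℝ) × ℝ × (Fin p → ℝ)) =>
      sampleg q.2.2.1 q.2.1 :=
    h1.comp (f := fun q : (Param p × Param p) × ((Fin p → ℝ) × ℝ × (Fin p → ℝ)) =>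
      (q.2.2.1, q.2.1)) (by fun_prop)
  have hG : Continuous fun q : (Param p × Param p) × ((Fin p → ℝ) × ℝ × (Fin p → ℝ)) =>
      sampleG γ q.2.1 q.2.2.2 := by
    unfold sampleG
    refine Continuous.matrix_fromBlocks ?_ ?_ (Continuous.neg ?_) continuous_const <;>
      exact Continuous.matrix_vecMulVec (by fun_prop) (by fun_prop)
  have hH : Continuous fun q : (Param p × Param p) × ((Fin p → ℝ) × ℝ × (Fin p → ℝ)) =>
      sampleH q.2.1 := by
    unfold sampleH
    exact Continuous.matrix_fromBlocks continuous_const continuous_const continuous_const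
      (Continuous.matrix_vecMulVec (by fun_prop) (by fun_prop))
  unfold centredDirection
  exact ((((hH.matrix_mulVec (by fun_prop)).const_smul κ).neg.sub
    (hG.matrix_mulVec (by fun_prop))).add (h2.sub (hG.matrix_mulVec continuous_const)))

theorem measurable_centredStep (α : ℝ) :
    Measurable (Function.uncurry (centredStep γ κ ρstar α)) := by
  have := continuous_centredDirection γ κ ρstar
  refine Continuous.measurable ?_
  simp only [Function.uncurry_def, centredStep]
  fun_prop

/-- Finitely many states bound all sampled matrices and features uniformly, by the sum of their
norms over the states. The reward is the only unbounded quantity, so its second moment is all that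
is needed. -/
theorem exists_norm_centredDirection_le {S : Type*} [Fintype S] (x : S → Fin p → ℝ) (hκ : 0 ≤ κ) :
    ∃ K, 0 ≤ K ∧ ∀ (u δ : Param p) (i j : S) (r : ℝ),
      ‖centredDirection γ κ ρstar u δ (x i, r, x j)‖ ^ 2 ≤
        K * (‖u‖ ^ 2 + ‖δ‖ ^ 2 + (r ^ 2 + 1)) := by
  let LH : S → Param p →L[ℝ] Param p := fun i => (sampleH (x i)).mulVecLin.toContinuousLinearMap
  let LG : S × S → Param p →L[ℝ] Param p := fun q =>
    (sampleG γ (x q.1) (x q.2)).mulVecLin.toContinuousLinearMap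
  set kH := ∑ i, ‖LH i‖ with hkH
  set kG := ∑ q, ‖LG q‖ with hkG
  set kx := ∑ i, ‖x i‖ with hkx
  have hkH0 : 0 ≤ kH := Finset.sum_nonneg fun _ _ => norm_nonneg _
  have hkG0 : 0 ≤ kG := Finset.sum_nonneg fun _ _ => norm_nonneg _
  have hkx0 : 0 ≤ kx := Finset.sum_nonneg fun _ _ => norm_nonneg _
  have hH : ∀ i δ, ‖sampleH (x i) *ᵥ δ‖ ≤ kH * ‖δ‖ := fun i δ =>
    ((LH i).le_opNorm δ).trans (mul_le_mul_of_nonneg_right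
      (Finset.single_le_sum (f := fun i => ‖LH i‖) (fun _ _ => norm_nonneg _) (Finset.mem_univ i))
      (norm_nonneg _))
  have hG : ∀ i j u, ‖sampleG γ (x i) (x j) *ᵥ u‖ ≤ kG * ‖u‖ := fun i j u =>
    ((LG (i, j)).le_opNorm u).trans (mul_le_mul_of_nonneg_right
      (Finset.single_le_sum (f := fun q => ‖LG q‖) (fun _ _ => norm_nonneg _)
        (Finset.mem_univ (i, j))) (norm_nonneg _))
  have hg : ∀ r i, ‖sampleg r (x i)‖ ≤ kx * |r| := fun r i => by
    have hxi : ‖x i‖ ≤ kx :=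
      Finset.single_le_sum (f := fun i => ‖x i‖) (fun _ _ => norm_nonneg _) (Finset.mem_univ i)
    refine (pi_norm_le_iff_of_nonneg (by positivity)).2 ?_
    rintro (l | l)
    · simp only [sampleg, Sum.elim_inl, Pi.smul_apply, smul_eq_mul, norm_mul, Real.norm_eq_abs]
      rw [mul_comm]
      exact mul_le_mul_of_nonneg_right ((norm_le_pi_norm (x i) l).trans hxi) (abs_nonneg _)
    · simp only [sampleg, Sum.elim_inr, Pi.zero_apply, norm_zero]; positivity
  set k := κ * kH + kG + kx + kG * ‖ρstar‖ with hk
  refine ⟨4 * k ^ 2, by positivity, fun u δ i j r => ?_⟩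
  have hk1 : κ * kH ≤ k := by have := mul_nonneg hkG0 (norm_nonneg ρstar); linarith
  have hk2 : kG ≤ k := by
    have := mul_nonneg hkG0 (norm_nonneg ρstar); have := mul_nonneg hκ hkH0; linarith
  have hk3 : kx ≤ k := by
    have := mul_nonneg hkG0 (norm_nonneg ρstar); have := mul_nonneg hκ hkH0; linarith
  have hk4 : kG * ‖ρstar‖ ≤ k := by have := mul_nonneg hκ hkH0; linarith
  have hle : ‖centredDirection γ κ ρstar u δ (x i, r, x j)‖ ≤ k * (‖u‖ + ‖δ‖ + |r| + 1) := by
    calc ‖centredDirection γ κ ρstar u δ (x i, r, x j)‖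
        ≤ (‖κ • (sampleH (x i) *ᵥ δ)‖ + ‖sampleG γ (x i) (x j) *ᵥ u‖) +
          (‖sampleg r (x i)‖ + ‖sampleG γ (x i) (x j) *ᵥ ρstar‖) := by
          refine (norm_add_le _ _).trans (add_le_add ((norm_sub_le _ _).trans ?_) (norm_sub_le _ _))
          rw [norm_neg]
      _ ≤ (κ * (kH * ‖δ‖) + kG * ‖u‖) + (kx * |r| + kG * ‖ρstar‖) := by
          rw [norm_smul, Real.norm_of_nonneg hκ]
          gcongr
          exacts [hH i δ, hG i j u, hg r i, hG i j ρstar]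
      _ ≤ k * (‖u‖ + ‖δ‖ + |r| + 1) := by
          have e1 := mul_le_mul_of_nonneg_right hk1 (norm_nonneg δ)
          have e2 := mul_le_mul_of_nonneg_right hk2 (norm_nonneg u)
          have e3 := mul_le_mul_of_nonneg_right hk3 (abs_nonneg r)
          linarith
  calc ‖centredDirection γ κ ρstar u δ (x i, r, x j)‖ ^ 2
      ≤ (k * (‖u‖ + ‖δ‖ + |r| + 1)) ^ 2 := by gcongr
    _ = k ^ 2 * (‖u‖ + ‖δ‖ + |r| + 1) ^ 2 := by ring
    _ ≤ k ^ 2 * (4 * (‖u‖ ^ 2 + ‖δ‖ ^ 2 + (r ^ 2 + 1))) := by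
        refine mul_le_mul_of_nonneg_left ?_ (sq_nonneg k)
        rw [← sq_abs r]
        nlinarith [sq_nonneg (‖u‖ - ‖δ‖), sq_nonneg (‖u‖ - |r|), sq_nonneg (‖u‖ - 1),
          sq_nonneg (‖δ‖ - |r|), sq_nonneg (‖δ‖ - 1), sq_nonneg (|r| - 1)]
    _ = _ := by ring

end CentredStep

/-! ### Mean drift of the centred iteration -/

section Drift

variable {S A Ω : Type*} [Fintype S] [DecidableEq S] [MeasurableSpace S]
  [DiscreteMeasurableSpace S] [Fintype A] [MeasurableSpace A] [DiscreteMeasurableSpace A]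
  [MeasurableSpace Ω] {μ : Measure Ω} [IsProbabilityMeasure μ]
  {M : MDP S A} {b : S → PMF A} {d : PMF S} {s : Ω → S} {a : Ω → A} {r : Ω → ℝ} {s' : Ω → S}
  {p : ℕ} (x : S → Fin p → ℝ)

/-- The mean direction of the iteration, centred at the point with weights solving the TD fixed
point equation. -/
theorem HasTransitionLaw.integral_centredDirection (h : HasTransitionLaw M b d μ s a r s')
    (hs : Measurable s) (ha : Measurable a) (hr : Measurable r) (hs' : Measurable s')
    (hint : Integrable r μ) (γ κ : ℝ) {wstar : Fin p → ℝ}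
    (hw : (tdMatrix M b γ x d)ᵀ *ᵥ wstar =
      ((featureMatrix x)ᵀ * stateWeights d) *ᵥ M.rewardVector b) (u δ : Param p) :
    Integrable (fun ω => centredDirection γ κ (Sum.elim 0 wstar) u δ
      (x (s ω), r ω, x (s' ω))) μ ∧
    ∫ ω, centredDirection γ κ (Sum.elim 0 wstar) u δ (x (s ω), r ω, x (s' ω)) ∂μ =
      -(κ • (Matrix.fromBlocks 0 0 0 (featureCov x d) *ᵥ δ)) -
        Matrix.fromBlocks (featureCov x d) (tdMatrix M b γ x d)ᵀ (-tdMatrix M b γ x d) 0 *ᵥ u := by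
  have hG := integrable_mulVec (μ := μ) (F := fun ω => sampleG γ (x (s ω)) (x (s' ω)))
    fun i j => integrable_comp_states hs hs' fun t t' => sampleG γ (x t) (x t') i j
  have hH := integrable_mulVec (μ := μ) (F := fun ω => sampleH (x (s ω)))
    fun i j => integrable_comp_states hs hs' fun t _ => sampleH (x t) i j
  simp only [h.expMatrix_sampleG x hs ha hr hs' γ] at hG
  simp only [h.expMatrix_sampleH x hs ha hr hs'] at hH
  obtain ⟨hg1, hg2⟩ := h.integral_sampleg x hs ha hr hs' hint
  have hHδ : Integrable (fun ω => κ • (sampleH (x (s ω)) *ᵥ δ)) μ := (hH δ).1.smul κ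
  -- The mean of `G_n` sends `ρ⋆` to the mean of `g_{n+1}`, so the constant noise term of the
  -- centred direction has mean zero.
  have e : Matrix.fromBlocks (featureCov x d) (tdMatrix M b γ x d)ᵀ (-tdMatrix M b γ x d) 0 *ᵥ
      Sum.elim 0 wstar =
      Sum.elim (((featureMatrix x)ᵀ * stateWeights d) *ᵥ M.rewardVector b) 0 := by
    rw [Matrix.fromBlocks_mulVec]
    simp [hw]
  have hi1 : Integrable (fun ω => -(κ • (sampleH (x (s ω)) *ᵥ δ))) μ := hHδ.neg
  have hi2 : Integrable (fun ω => -(κ • (sampleH (x (s ω)) *ᵥ δ)) -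
      sampleG γ (x (s ω)) (x (s' ω)) *ᵥ u) μ := hi1.sub (hG u).1
  have hi3 : Integrable (fun ω => sampleg (r ω) (x (s ω)) -
      sampleG γ (x (s ω)) (x (s' ω)) *ᵥ Sum.elim 0 wstar) μ := hg1.sub (hG _).1
  simp only [centredDirection]
  refine ⟨hi2.add hi3, ?_⟩
  rw [integral_add hi2 hi3, integral_sub hi1 (hG u).1, integral_sub hg1 (hG _).1, integral_neg, integral_smul, (hH δ).2, (hG u).2, (hG _).2, hg2, e,
    sub_self, add_zero]

end Drift

/-- Compactness upgrades strict positivity to `B u (G u) ≥ ‖u‖² / K₀`. Young's inequality spends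
half of this on the mixed term in `u` and `δ`, leaving a multiple of `‖δ‖²`. -/
theorem exists_drift_bound {p : ℕ} (B : Param p →L[ℝ] Param p →L[ℝ] ℝ)
    {G H : Matrix (Fin p ⊕ Fin p) (Fin p ⊕ Fin p) ℝ} (κ : ℝ)
    (hG : ∀ u, u ≠ 0 → 0 < B u (G *ᵥ u)) :
    ∃ c > 0, ∃ K ≥ 0, ∀ u δ : Param p,
      B u (-(κ • (H *ᵥ δ)) - G *ᵥ u) ≤ -c * ‖u‖ ^ 2 + K * ‖δ‖ ^ 2 := by
  obtain ⟨K₀, hK₀, hle⟩ := exists_le_mul_of_homogeneous (q₁ := fun u : Param p => B u (G *ᵥ u))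
    (q₂ := fun u => ‖u‖ ^ 2) (by fun_prop) (by fun_prop)
    (fun t v => by simp [Matrix.mulVec_smul]; ring)
    (fun t v => by simp [norm_smul, mul_pow]) hG
  set LH : Param p →L[ℝ] Param p := H.mulVecLin.toContinuousLinearMap
  set m := ‖B‖ * (|κ| * ‖LH‖) with hm
  refine ⟨1 / (2 * K₀), by positivity, m ^ 2 * K₀ / 2, by positivity, fun u δ => ?_⟩
  have h1 : B u (G *ᵥ u) ≥ 1 / K₀ * ‖u‖ ^ 2 := by
    have := hle u
    rw [ge_iff_le, div_mul_eq_mul_div, div_le_iff₀ hK₀]; linarith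
  have h2 : -(B u (κ • (H *ᵥ δ))) ≤ m * ‖u‖ * ‖δ‖ := by
    calc -(B u (κ • (H *ᵥ δ))) ≤ ‖B u (κ • (H *ᵥ δ))‖ := neg_le_abs _
      _ ≤ ‖B‖ * ‖u‖ * ‖κ • (H *ᵥ δ)‖ := B.le_opNorm₂ _ _
      _ ≤ ‖B‖ * ‖u‖ * (|κ| * (‖LH‖ * ‖δ‖)) := by
          rw [norm_smul, Real.norm_eq_abs]
          gcongr
          exact LH.le_opNorm δ
      _ = _ := by ring
  have h3 : m * ‖u‖ * ‖δ‖ ≤ 1 / (2 * K₀) * ‖u‖ ^ 2 + m ^ 2 * K₀ / 2 * ‖δ‖ ^ 2 := by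
    have : 0 ≤ 1 / (2 * K₀) * (‖u‖ - K₀ * m * ‖δ‖) ^ 2 := by positivity
    have e : 1 / (2 * K₀) * (‖u‖ - K₀ * m * ‖δ‖) ^ 2 =
        1 / (2 * K₀) * ‖u‖ ^ 2 + m ^ 2 * K₀ / 2 * ‖δ‖ ^ 2 - m * ‖u‖ * ‖δ‖ := by
      field_simp; ring
    linarith
  have h4 : 1 / K₀ * ‖u‖ ^ 2 = 1 / (2 * K₀) * ‖u‖ ^ 2 + 1 / (2 * K₀) * ‖u‖ ^ 2 := by
    field_simp; ring
  rw [map_sub, map_neg]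
  linarith

/-- For small step sizes, the pair of the centred iterate and the increment tends to zero almost
surely, from all starting points simultaneously. -/
theorem ae_tendsto_trajectory {S A Ω : Type*}
    [Fintype S] [DecidableEq S] [MeasurableSpace S] [DiscreteMeasurableSpace S]
    [Fintype A] [MeasurableSpace A] [DiscreteMeasurableSpace A]
    [MeasurableSpace Ω] {μ : Measure Ω} [IsProbabilityMeasure μ]
    {M : MDP S A} {b : S → PMF A} {d : PMF S} {p : ℕ} {x : S → Fin p → ℝ} {γ κ : ℝ} (hκ : 0 ≤ κ)
    {s : ℕ → Ω → S} {a : ℕ → Ω → A} {r : ℕ → Ω → ℝ} {s' : ℕ → Ω → S}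
    (hs : ∀ n, Measurable (s n)) (ha : ∀ n, Measurable (a n))
    (hr : ∀ n, Measurable (r n)) (hs' : ∀ n, Measurable (s' n))
    (hlaw : ∀ n, HasTransitionLaw M b d μ (s n) (a n) (r n) (s' n))
    (hindep : iIndepFun (fun n ω => (x (s n ω), r n ω, x (s' n ω))) μ)
    (hmoment : ∃ C : ℝ, ∀ n, Integrable (fun ω => r n ω ^ 2) μ ∧ ∫ ω, r n ω ^ 2 ∂μ ≤ C)
    (hA : IsUnit (tdMatrix M b γ x d).det) (hC : IsUnit (featureCov x d).det)
    {wstar : Fin p → ℝ} (hw : (tdMatrix M b γ x d)ᵀ *ᵥ wstar =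
      ((featureMatrix x)ᵀ * stateWeights d) *ᵥ M.rewardVector b) :
    ∃ α₀ > 0, ∀ (α : ℕ → ℝ) (k : ℕ), (∀ n, 0 ≤ α n) → (∀ n, α n ≤ α₀) → ¬ Summable α →
      Summable (fun n => α n ^ 2) → ∀ᵐ ω ∂μ, ∀ z, Tendsto (fun n => trajectory
        (fun n => centredStep γ κ (Sum.elim 0 wstar) (α n))
        (fun n => (x (s (n + k) ω), r (n + k) ω, x (s' (n + k) ω))) n z) atTop (𝓝 0) := by
  set ρstar : Param p := Sum.elim 0 wstar with hρstar
  obtain ⟨R, hR⟩ := hmoment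
  have hR0 : 0 ≤ R := (integral_nonneg fun ω => sq_nonneg _).trans (hR 0).2
  have hrint : ∀ n, Integrable (r n) μ := fun n =>
    ((memLp_two_iff_integrable_sq (hr n).aestronglyMeasurable).2 (hR n).1).integrable (by norm_num)
  obtain ⟨B, hsymm, hBpos, hBG⟩ := exists_lyapunov_form (fun v hv => featureCov_pos x hC hv) hA
  have hB0 : ∀ u, 0 ≤ B u u := fun u => by
    rcases eq_or_ne u 0 with rfl | hu
    · simp
    · exact (hBpos u hu).le
  obtain ⟨c, hc, K₁, hK₁, hdrift⟩ :=
    exists_drift_bound B (H := Matrix.fromBlocks 0 0 0 (featureCov x d)) κ hBG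
  obtain ⟨K₂, hK₂, hbound⟩ := exists_norm_centredDirection_le γ κ ρstar x hκ
  -- The sum `K₁ + K₂` serves both the drift and the norm bound; `R + 1` bounds the mean of `r ^ 2 +
  -- 1`.
  obtain ⟨α₀, hα₀, c', hc', C, hC0, hstep⟩ := exists_lyapunov_drift μ B hsymm hc
    (add_nonneg hK₁ hK₂) (add_nonneg hR0 zero_le_one)
  obtain ⟨K₃, hK₃, hcoer⟩ := exists_le_mul_of_homogeneous (q₁ := fun u : Param p => B u u)
    (q₂ := fun u => ‖u‖ ^ 2) (by fun_prop) (by fun_prop)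
    (fun t v => by simp; ring) (fun t v => by simp [norm_smul, mul_pow]) hBpos
  refine ⟨α₀, hα₀, fun α k hα hαle hsum hsq => ?_⟩
  set Y : ℕ → Ω → (Fin p → ℝ) × ℝ × (Fin p → ℝ) :=
    fun n ω => (x (s (n + k) ω), r (n + k) ω, x (s' (n + k) ω)) with hYdef
  have hY : ∀ n, Measurable (Y n) := fun n =>
    ((measurable_of_finite x).comp (hs _)).prodMk
      ((hr _).prodMk ((measurable_of_finite x).comp (hs' _)))
  have hind : iIndepFun Y μ := hindep.precomp (g := fun n => n + k) (add_left_injective k)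
  set Φ : ℕ → Param p × Param p → (Fin p → ℝ) × ℝ × (Fin p → ℝ) → Param p × Param p :=
    fun n => centredStep γ κ ρstar (α n) with hΦdef
  set W : Param p × Param p → ℝ := fun z => B z.1 z.1 + ‖z.2‖ ^ 2 with hWdef
  have hWc : Continuous W := by fun_prop
  have hW0 : ∀ z, 0 ≤ W z := fun z => add_nonneg (hB0 _) (sq_nonneg _)
  have hone : ∀ n z, Integrable (fun ω => W (Φ n z (Y n ω))) μ ∧
      ∫ ω, W (Φ n z (Y n ω)) ∂μ ≤ (1 - c' * α n) * W z + C * α n ^ 2 := by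
    intro n z
    obtain ⟨hF, hFmean⟩ := (hlaw (n + k)).integral_centredDirection x (hs _) (ha _) (hr _) (hs' _)
      (hrint _) γ κ hw z.1 z.2
    refine hstep z.1 z.2 (fun ω => centredDirection γ κ ρstar z.1 z.2 (Y n ω))
      (fun ω => r (n + k) ω ^ 2 + 1) (α n) (hα n) (hαle n) hF.aestronglyMeasurable
      ((hR _).1.add (integrable_const _)) ?_ (fun ω => ?_) ?_
    · rw [integral_add (hR _).1 (integrable_const _)]
      simpa using (hR (n + k)).2
    · refine (hbound z.1 z.2 _ _ _).trans (mul_le_mul_of_nonneg_right ?_ (by positivity))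
      linarith
    · rw [(B z.1).integral_comp_comm hF, hFmean]
      refine (hdrift z.1 z.2).trans ?_
      have := mul_nonneg hK₂ (sq_nonneg ‖z.2‖)
      linarith
  have hpoint : ∀ z₀, ∀ᵐ ω ∂μ, Tendsto (fun n => trajectory Φ (fun n => Y n ω) n z₀) atTop (𝓝 0) := by
    intro z₀
    have hWlim := ae_tendsto_zero_of_lyapunov hY hind
      (fun n => measurable_centredStep γ κ ρstar (α n)) hWc.measurable hW0
      (a := fun n => c' * α n) (b := fun n => C * α n ^ 2)
      (fun n => mul_nonneg hc'.le (hα n)) (fun n => mul_nonneg hC0 (sq_nonneg _))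
      (fun h => hsum ((summable_mul_left_iff hc'.ne').1 h)) (hsq.mul_left C)
      (fun n z => (hone n z).1) (fun n z => (hone n z).2)
      (z := fun n ω => trajectory Φ (fun n => Y n ω) n z₀) z₀ (fun ω => rfl) (fun n ω => rfl)
    filter_upwards [hWlim] with ω hω
    have h1 : Tendsto (fun n => (trajectory Φ (fun n => Y n ω) n z₀).1) atTop (𝓝 0) := by
      rw [tendsto_zero_iff_norm_tendsto_zero]
      have : Tendsto (fun n => ‖(trajectory Φ (fun n => Y n ω) n z₀).1‖ ^ 2) atTop (𝓝 0) := by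
        refine squeeze_zero (fun n => sq_nonneg _) (fun n => ?_) (by simpa using hω.const_mul K₃)
        refine (hcoer _).trans (mul_le_mul_of_nonneg_left ?_ hK₃.le)
        exact le_add_of_nonneg_right (sq_nonneg _)
      simpa using this.sqrt
    have h2 : Tendsto (fun n => (trajectory Φ (fun n => Y n ω) n z₀).2) atTop (𝓝 0) := by
      rw [tendsto_zero_iff_norm_tendsto_zero]
      have : Tendsto (fun n => ‖(trajectory Φ (fun n => Y n ω) n z₀).2‖ ^ 2) atTop (𝓝 0) :=
        squeeze_zero (fun n => sq_nonneg _) (fun n => le_add_of_nonneg_left (hB0 _)) hω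
      simpa using this.sqrt
    exact h1.prodMk_nhds h2
  -- Only finitely many null sets are discarded, which moves the quantifier over starting points
  -- inside the almost sure statement.
  let v := Module.finBasis ℝ (Param p × Param p)
  filter_upwards [hpoint 0, ae_all_iff.2 fun i => hpoint (v i)] with ω h0 hv z
  exact tendsto_zero_of_basis v (fun n t z z' => trajectory_affine
    (fun n y t z z' z'' => centredStep_affine γ κ ρstar (α n) y t z z' z'') _ n t z z') h0 hv z

theorem theorem1 {S A Ω : Type*}
    [Fintype S] [DecidableEq S] [MeasurableSpace S] [DiscreteMeasurableSpace S]
    [Fintype A] [MeasurableSpace A] [DiscreteMeasurableSpace A]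
    [MeasurableSpace Ω] (μ : Measure Ω) [IsProbabilityMeasure μ]
    -- the decision process, the behavior policy, the state distribution, the features
    (M : MDP S A) (b : S → PMF A) (d : PMF S) {p : ℕ} (x : S → Fin p → ℝ)
    (γ : ℝ) (hγ : γ ∈ Set.Ico (0 : ℝ) 1)
    -- step sizes
    (α : ℕ → ℝ) (hα : ∀ n, 1 ≤ n → α n ∈ Set.Ioo (0 : ℝ) 1)
    (hα_sum : Tendsto (fun N => ∑ n ∈ Finset.Icc 1 N, α n) atTop atTop)
    (hα_sq : Summable fun n => α n ^ 2)
    -- the sampled transitions (state, action, reward, next state)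
    (s : ℕ → Ω → S) (a : ℕ → Ω → A) (r : ℕ → Ω → ℝ) (s' : ℕ → Ω → S)
    (hs : ∀ n, Measurable (s n)) (ha : ∀ n, Measurable (a n))
    (hr : ∀ n, Measurable (r n)) (hs' : ∀ n, Measurable (s' n))
    (hlaw : ∀ n, HasTransitionLaw M b d μ (s n) (a n) (r n) (s' n))
    (hindep : iIndepFun (fun n ω => (x (s n ω), r n ω, x (s' n ω))) μ)
    (hmoment : ∃ C : ℝ, ∀ n, Integrable (fun ω => r n ω ^ 2) μ ∧ ∫ ω, r n ω ^ 2 ∂μ ≤ C)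
    -- non-singularity
    (hA : ∀ n, IsUnit (expMatrix μ fun ω =>
      Matrix.vecMulVec (x (s n ω) - γ • x (s' n ω)) (x (s n ω))).det)
    (hC : ∀ n, IsUnit (expMatrix μ fun ω =>
      Matrix.vecMulVec (x (s n ω)) (x (s n ω))).det)
    -- the regularization parameter
    (κ : ℝ) (hκ : 0 ≤ κ)
    -- the iterates, with arbitrary random initial vectors `ρ 0` and `ρ 1`
    (ρ : ℕ → Ω → Param p) (hρ0 : Measurable (ρ 0)) (hρ1 : Measurable (ρ 1))
    (hρ : ∀ n, 1 ≤ n → ∀ ω, ρ (n + 1) ω =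
      gradientDDStep γ κ (α n) (r n ω) (x (s n ω)) (x (s' n ω)) (ρ n ω) (ρ (n - 1) ω))
    (hbdd : BoundedInProbability μ fun n ω => ρ (n + 1) ω - ρ n ω) :
    (∃! w : Fin p → ℝ, IsTDFixedPoint M b γ x d w) ∧
      ∀ wstar : Fin p → ℝ, IsTDFixedPoint M b γ x d wstar →
        ∀ᵐ ω ∂μ, Tendsto (fun n => (ρ n ω).weights) atTop (𝓝 wstar) := by
  have hcov : featureCov x d =
      expMatrix μ fun ω => Matrix.vecMulVec (x (s 0 ω)) (x (s 0 ω)) := by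
    ext i j
    exact ((hlaw 0).integral_cov_eq x (hs 0) (ha 0) (hr 0) (hs' 0) i j).symm
  have htd : tdMatrix M b γ x d = expMatrix μ fun ω =>
      Matrix.vecMulVec (x (s 0 ω) - γ • x (s' 0 ω)) (x (s 0 ω)) := by
    ext i j
    exact ((hlaw 0).integral_td_eq x (hs 0) (ha 0) (hr 0) (hs' 0) γ i j).symm
  have hCdet : IsUnit (featureCov x d).det := hcov ▸ hC 0
  have hAdet : IsUnit (tdMatrix M b γ x d).det := htd ▸ hA 0
  have hATdet : IsUnit (tdMatrix M b γ x d)ᵀ.det := by rwa [Matrix.det_transpose]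
  refine ⟨?_, fun wstar hwstar => ?_⟩
  · refine ⟨(tdMatrix M b γ x d)ᵀ⁻¹ *ᵥ
      (((featureMatrix x)ᵀ * stateWeights d) *ᵥ M.rewardVector b), ?_, fun w hw => ?_⟩
    · simp only [isTDFixedPoint_iff x hCdet]
      rw [Matrix.mulVec_mulVec, Matrix.mul_nonsing_inv _ hATdet, Matrix.one_mulVec]
    · rw [← (isTDFixedPoint_iff x hCdet γ w).1 hw, Matrix.mulVec_mulVec,
        Matrix.nonsing_inv_mul _ hATdet, Matrix.one_mulVec]
  have hw := (isTDFixedPoint_iff x hCdet γ wstar).1 hwstar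
  obtain ⟨α₀, hα₀, htraj⟩ := ae_tendsto_trajectory hκ hs ha hr hs' hlaw hindep hmoment hAdet hCdet hw
  have hαlim : Tendsto α atTop (𝓝 0) := by
    have := hα_sq.tendsto_atTop_zero.sqrt
    simp only [Real.sqrt_sq_eq_abs, Real.sqrt_zero] at this
    exact (tendsto_zero_iff_abs_tendsto_zero α).2 this
  -- The chain is started at time `N + 1`: the steps are then below `α₀`, and the index is at least
  -- `1`, where the recursion and the sign of `α` are available.
  obtain ⟨N, hN⟩ := eventually_atTop.1 (hαlim.eventually (ge_mem_nhds hα₀))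
  have hnot : ¬ Summable fun n => α (n + (N + 1)) := by
    rw [summable_nat_add_iff]
    intro h
    have h1 : Tendsto (fun n => ∑ i ∈ Finset.range (n + 1), α i - α 0) atTop
        (𝓝 (∑' i, α i - α 0)) :=
      ((h.hasSum.tendsto_sum_nat).comp (tendsto_add_atTop_nat 1)).sub_const _
    refine not_tendsto_nhds_of_tendsto_atTop hα_sum _ (h1.congr fun n => ?_)
    rw [Finset.range_eq_Ico, Finset.sum_eq_sum_Ico_succ_bot n.succ_pos, add_sub_cancel_left]
    rfl
  have hlim := htraj (fun n => α (n + (N + 1))) (N + 1) (fun n => (hα _ (by omega)).1.le)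
    (fun n => hN _ (by omega)) hnot ((summable_nat_add_iff (N + 1)).2 hα_sq)
  filter_upwards [hlim] with ω hω
  set ρstar : Param p := Sum.elim 0 wstar with hρstar
  have heq : ∀ n, trajectory (fun n => centredStep γ κ ρstar (α (n + (N + 1))))
      (fun n => (x (s (n + (N + 1)) ω), r (n + (N + 1)) ω, x (s' (n + (N + 1)) ω))) n
      (ρ (N + 1) ω - ρstar, ρ (N + 1) ω - ρ N ω) =
      (ρ (n + (N + 1)) ω - ρstar, ρ (n + (N + 1)) ω - ρ (n + N) ω) := by
    intro n
    induction n with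
    | zero => simp [trajectory]
    | succ n ih =>
      rw [trajectory, ih, centredStep_sub]
      have := hρ (n + (N + 1)) (by omega) ω
      rw [show n + (N + 1) - 1 = n + N by omega] at this
      rw [← this, show n + 1 + (N + 1) = n + (N + 1) + 1 by omega,
        show n + 1 + N = n + (N + 1) by omega]
  -- The random state at time `N + 1` is a legitimate start, since the null set does not depend on
  -- the starting point.
  have h1 := hω (ρ (N + 1) ω - ρstar, ρ (N + 1) ω - ρ N ω)
  simp only [heq] at h1
  have h2 : Tendsto (fun n => ρ n ω) atTop (𝓝 ρstar) := by
    rw [← tendsto_add_atTop_iff_nat (N + 1)]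
    have := (continuous_fst.tendsto _).comp h1
    exact tendsto_sub_nhds_zero_iff.1 this
  exact tendsto_pi_nhds.2 fun i => (tendsto_pi_nhds.1 h2) (Sum.inr i)
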